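/- Let $(\Omega,d)$ be a compact metric space with a probability measure $m$ for which open sets are measurable, and suppose that there are constants $\delta,a,b,r_0>0$ such that $$a\,r^\delta\le m(B(x,r))\le b\,r^\delta\qquad(x\in\Omega,\ 0<r\le r_0)\,,\tag{M2}$$ where $B(x,r)=\{y\in\Omega:d(x,y)<r\}$. Let $J$ be an infinite countable set, $\mathcal R=(R_\alpha)_{\alpha\in J}$ a family of subsets of $\Omega$ (the resonant sets), and $\beta:J\to(0,\infty)$, $\alpha\mapsto\beta_\alpha$, a function such that $\{\alpha\in J:\beta_\alpha\le T\}$ is finite for every $T$. For $A\subseteq\Omega$ and $t>0$ put $\Delta(A,t)=\{x\in\Omega:\operatorname{dist}(x,A)<t\}$ (with $\Delta(\emptyset,t)=\emptyset$). For a decreasing function $\psi:(0,\infty)\to(0,\infty)$ let $$\Lambda(\psi)=\{x\in\Omega: x\in\Delta(R_\alpha,\psi(\beta_\alpha))\text{ for infinitely many }\alpha\in J\}.$$ Let $l=(l_n)$ and $u=(u_n)$ be increasing sequences of positive reals with $l_n<u_n$ and $l_n\to\infty$, and let $\rho:(0,\infty)\to(0,\infty)$ satisfy $\rho(r)\to0$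 as $r\to\infty$. Suppose that $(\mathcal R,\beta)$ is locally $m$-ubiquitous relative to $(\rho,l,u)$ with common dimension $\gamma$; that is: (a) there are constants $\kappa,r_1>0$ such that for every ball $B=B(x,r)$ with $x\in\Omega$ and $0<r\le r_1$ there is an $n_0(B)$ with $$m\Big(B\cap\bigcup_{\alpha\in J:\ l_n<\beta_\alpha\le u_n}\Delta(R_\alpha,\rho(u_n))\Big)\ \ge\ \kappa\,m(B)\qquad(n\ge n_0(B));$$ (b) $0\le\gamma\le\dim\Omega$ (Hausdorff dimension), and there are constants $c_1,c_2>0$ such that for all sufficiently large $n$, all $\alpha\in J$ with $\beta_\alpha\le u_n$, all $c\in R_\alpha$ and all $0<\lambda\le\rho(u_n)$, $$m\big(B(c,\tfrac12\rho(u_n))\cap\Delta(R_\alpha,\lambda)\big)\ \ge\ c_1\,m(B(c,\lambda))\Big(\frac{\rho(u_n)}{\lambda}\Big)^{\gamma},$$ $$m\big(B\cap B(c,3\rho(u_n))\cap\Delta(R_\alpha,3\lambda)\big)\ \le\ c_2\,m(B(c,\lambda))\Big(\frac{r(B)}{\lambda}\Big)^{\gamma}$$ for every ball $B$ of radius $0<r(B)\le3\rho(u_n)$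 centred at a point of some resonant set. Let $\psi:(0,\infty)\to(0,\infty)$ be decreasing, and let $f:(0,\infty)\to(0,\infty)$ be a dimension function, i.e. increasing and continuous with $f(r)\to0$ as $r\to0$. Suppose that $r^{-\delta}f(r)\to\infty$ as $r\to0$, that $r^{-\delta}f(r)$ is decreasing, and that $r^{-\gamma}f(r)$ is increasing (monotonicity is meant in the weak sense throughout). Define $$g(r)=f(\psi(r))\,\psi(r)^{-\gamma}\rho(r)^{\gamma-\delta},\qquad G=\limsup_{n\to\infty}g(u_n)\in[0,\infty].$$ The Hausdorff $f$-measure of $F\subseteq\Omega$ is $\mathcal H^f(F)=\sup_{t>0}\inf\big\{\sum_i f(r_i)\big\}$, the infimum being over all countable covers of $F$ by balls $B(x_i,r_i)$ with $x_i\in\Omega$ and $0<r_i\le t$. (i) Suppose that $G=0$ and that $\rho$ is $u$-regular, i.e. there is a constant $0<c<1$ with $\rho(u_{n+1})\le c\,\rho(u_n)$ for all sufficiently large $n$. If $\sum_{n}g(u_n)=\infty$, then $\mathcal H^f(\Lambda(\psi))=\infty$. (ii) If $0<G\le\infty$, then $\mathcal H^f(\Lambda(\psi))=\infty$. -/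

import Mathlib

open Set Filter Topology MeasureTheory

namespace Ubiquity

/-- A dimension function: a positive, increasing, continuous function on `(0, ∞)` tending to `0`
at `0`. Only the values on `(0, ∞)` are relevant. -/
structure IsDimensionFunction (f : ℝ → ℝ) : Prop where
  pos : ∀ r, 0 < r → 0 < f r
  mono : MonotoneOn f (Ioi 0)
  cont : ContinuousOn f (Ioi 0)
  lim : Tendsto f (𝓝[>] 0) (𝓝 0)

/-- The infimum of `∑ f (rᵢ)` over all countable covers of `F` by balls of radii `0 < rᵢ ≤ t`.
A cover is recorded as a countable set of pairs (centre, radius). -/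
noncomputable def hausdorffPre {Ω : Type*} [MetricSpace Ω] (f : ℝ → ℝ) (t : ℝ) (F : Set Ω) :
    ENNReal :=
  ⨅ (C : Set (Ω × ℝ)) (_ : C.Countable) (_ : ∀ p ∈ C, 0 < p.2 ∧ p.2 ≤ t)
    (_ : F ⊆ ⋃ p ∈ C, Metric.ball p.1 p.2), ∑' p : C, ENNReal.ofReal (f (p : Ω × ℝ).2)

/-- The Hausdorff `f`-measure of `F`. -/
noncomputable def hausdorffMeasureFun {Ω : Type*} [MetricSpace Ω] (f : ℝ → ℝ) (F : Set Ω) :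
    ENNReal :=
  ⨆ (t : ℝ) (_ : 0 < t), hausdorffPre f t F

/-- The measure of every ball of small radius `r` is comparable to `r ^ δ`, where `δ > 0`. -/
def PowerLaw {Ω : Type*} [MetricSpace Ω] [MeasurableSpace Ω] (m : Measure Ω) (δ : ℝ) : Prop :=
  0 < δ ∧ ∃ a b r₀ : ℝ, 0 < a ∧ 0 < b ∧ 0 < r₀ ∧ ∀ (x : Ω) (r : ℝ), 0 < r → r ≤ r₀ →
    ENNReal.ofReal (a * r ^ δ) ≤ m (Metric.ball x r) ∧
      m (Metric.ball x r) ≤ ENNReal.ofReal (b * r ^ δ)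

/-- The weights are positive, and only finitely many of them lie below any given bound. -/
structure IsWeight {J : Type*} (β : J → ℝ) : Prop where
  pos : ∀ α, 0 < β α
  finite_le : ∀ T : ℝ, {α | β α ≤ T}.Finite

/-- Lower and upper sequences: positive and increasing, with `l n < u n` and `l n → ∞`. -/
structure IsLowerUpper (l u : ℕ → ℝ) : Prop where
  l_pos : ∀ n, 0 < l n
  l_mono : Monotone l
  u_mono : Monotone u
  lt : ∀ n, l n < u n
  l_lim : Tendsto l atTop atTop

/-- An approximating function: positive and decreasing on `(0, ∞)`. -/
structure IsApproximating (ψ : ℝ → ℝ) : Prop where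
  pos : ∀ r, 0 < r → 0 < ψ r
  anti : AntitoneOn ψ (Ioi 0)

/-- A (candidate) ubiquitous function: positive on `(0, ∞)` and tending to `0` at infinity. -/
structure IsUbiquityFunction (ρ : ℝ → ℝ) : Prop where
  pos : ∀ r, 0 < r → 0 < ρ r
  lim : Tendsto ρ atTop (𝓝 0)

/-- The points lying in infinitely many of the neighbourhoods of radius `ψ (β α)` of the resonant
sets `R α`. (The neighbourhood of an empty set is empty.) -/
def limsupSet {Ω J : Type*} [MetricSpace Ω] (R : J → Set Ω) (β : J → ℝ) (ψ : ℝ → ℝ) : Set Ω :=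
  {x | {α | x ∈ Metric.thickening (ψ (β α)) (R α)}.Infinite}

/-- The union of the neighbourhoods of radius `ρ (u n)` of the resonant sets `R α` with
`l n < β α ≤ u n`. -/
def unionNhd {Ω J : Type*} [MetricSpace Ω] (R : J → Set Ω) (β : J → ℝ) (ρ : ℝ → ℝ)
    (l u : ℕ → ℝ) (n : ℕ) : Set Ω :=
  ⋃ (α : J) (_ : l n < β α ∧ β α ≤ u n), Metric.thickening (ρ (u n)) (R α)

/-- The intersection conditions with common dimension `γ`. In the second inequality `ball y s` is
an arbitrary ball centred at a point of some resonant set. -/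
def IntersectionConditions {Ω J : Type*} [MetricSpace Ω] [MeasurableSpace Ω] (m : Measure Ω)
    (R : J → Set Ω) (β : J → ℝ) (ρ : ℝ → ℝ) (u : ℕ → ℝ) (γ : ℝ) : Prop :=
  0 ≤ γ ∧ ENNReal.ofReal γ ≤ dimH (univ : Set Ω) ∧
  ∃ c₁ c₂ : ℝ, 0 < c₁ ∧ 0 < c₂ ∧ ∀ᶠ n in atTop, ∀ α : J, β α ≤ u n → ∀ c ∈ R α, ∀ t : ℝ,
    0 < t → t ≤ ρ (u n) →
    ENNReal.ofReal c₁ * m (Metric.ball c t) * ENNReal.ofReal ((ρ (u n) / t) ^ γ) ≤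
        m (Metric.ball c (ρ (u n) / 2) ∩ Metric.thickening t (R α)) ∧
      ∀ y ∈ ⋃ α' : J, R α', ∀ s : ℝ, 0 < s → s ≤ 3 * ρ (u n) →
        m (Metric.ball y s ∩ Metric.ball c (3 * ρ (u n)) ∩ Metric.thickening (3 * t) (R α)) ≤
          ENNReal.ofReal c₂ * m (Metric.ball c t) * ENNReal.ofReal ((s / t) ^ γ)

/-- `(R, β)` is a local `m`-ubiquitous system relative to `(ρ, l, u)`, where `γ` is the common
dimension in the intersection conditions. -/
def LocallyUbiquitous {Ω J : Type*} [MetricSpace Ω] [MeasurableSpace Ω] (m : Measure Ω)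
    (R : J → Set Ω) (β : J → ℝ) (ρ : ℝ → ℝ) (l u : ℕ → ℝ) (γ : ℝ) : Prop :=
  (∃ κ r₀ : ℝ, 0 < κ ∧ 0 < r₀ ∧ ∀ (x : Ω) (r : ℝ), 0 < r → r ≤ r₀ → ∀ᶠ n in atTop,
    ENNReal.ofReal κ * m (Metric.ball x r) ≤ m (Metric.ball x r ∩ unionNhd R β ρ l u n)) ∧
  IntersectionConditions m R β ρ u γ

/-- `h` is `u`-regular. -/
def IsRegularAlong (u : ℕ → ℝ) (h : ℝ → ℝ) : Prop :=
  ∃ c : ℝ, 0 < c ∧ c < 1 ∧ ∀ᶠ n in atTop, h (u (n + 1)) ≤ c * h (u n)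

/-- The function `g (r) = f (ψ (r)) ψ (r) ^ (-γ) ρ (r) ^ (γ - δ)`. -/
noncomputable def gFun (f ψ ρ : ℝ → ℝ) (γ δ : ℝ) (r : ℝ) : ℝ :=
  f (ψ r) * ψ r ^ (-γ) * ρ r ^ (γ - δ)

/-- `G = limsup g (u n)`, an element of `[0, ∞]`. -/
noncomputable def limsupG (f ψ ρ : ℝ → ℝ) (γ δ : ℝ) (u : ℕ → ℝ) : ENNReal :=
  limsup (fun n => ENNReal.ofReal (gFun f ψ ρ γ δ (u n))) atTop

end Ubiquity

set_option linter.unusedSectionVars false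

namespace Ubiquity

/-! Mass distribution: if a probability measure gives every ball of radius `r ≤ t` mass at most `f r
/ η`, every cover by such balls costs at least `η`. For each `η` one builds decreasing compact sets
whose intersection lies in the limsup set, with measures obeying this bound at every stage. By
compactness an open cover of the intersection already covers one stage, so no limit measure is
needed (`hausdorffMeasureFun_limsup_eq_top`).

A stage is refined by local measures (`LevelSystem.exists_local_measure`): inside `B(x₀, s)` there
is one giving `B(x, r)` mass at most `ε s^(-δ) f r`, with `ε` as small as desired. At level `n`
ubiquity supplies about `(s / ρ n)^δ` separated balls of radius `ρ n` centred on resonant sets; in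
each of them `m` is restricted to a thin neighbourhood of the resonant set. Weighted by `g n`, the
level has total mass about `g n * s^δ`, and the intersection conditions bound the mass that one
piece gives to `B(x, r)` by a multiple of `f r`. Adding levels until the weights sum to about `K`
raises the total to about `K s^δ`. If pieces of different levels are kept apart, a ball meets at
most one piece of the levels with `ρ n > r`, while the remaining levels contribute about `K r^δ =
o(f r)`. Normalising leaves a constant of order `1 / K`, so divergence of the sum of `g` is what
makes the Hausdorff measure infinite.

Pieces are kept apart by discarding centres near earlier pieces; lacunarity of `ρ` and `t^δ = o(f
t)` ensure that at most half are lost (`LevelSystem.le_card_goodCentres`). A lacunary subsequence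
with divergent sum comes from regularity in (i), and from sparse selection of indices with `g`
bounded below in (ii). -/

/-- In a compact metric space, every set contains a finite `D`-separated `D`-net of itself. -/
theorem exists_finset_separated_net {Ω : Type*} [MetricSpace Ω] [CompactSpace Ω] (P : Set Ω)
    {D : ℝ} (hD : 0 < D) :
    ∃ S : Finset Ω, (S : Set Ω) ⊆ P ∧ (S : Set Ω).Pairwise (fun x y => D ≤ dist x y) ∧
      ∀ x ∈ P, ∃ y ∈ S, dist x y < D := by
  obtain ⟨S, hS⟩ := zorn_subset {S : Set Ω | S ⊆ P ∧ S.Pairwise (fun x y => D ≤ dist x y)} (by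
    intro c hc hchain
    refine ⟨⋃₀ c, ⟨sUnion_subset fun s hs => (hc hs).1, ?_⟩, fun s hs => subset_sUnion_of_mem hs⟩
    exact (pairwise_sUnion hchain.directedOn).2 fun s hs => (hc hs).2)
  have hSP := hS.prop.1
  have hSD := hS.prop.2
  -- A ball of radius `D / 2` contains at most one point of `S`, so a finite cover by such balls
  -- bounds `S`.
  have hfin : S.Finite := by
    obtain ⟨t, -, ht, hcov⟩ := finite_cover_balls_of_compact (isCompact_univ (X := Ω))
      (half_pos hD)
    have hex : ∀ x : Ω, ∃ y ∈ t, dist x y < D / 2 := fun x => by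
      simpa using hcov (mem_univ x)
    choose φ hφt hφ using hex
    refine Set.Finite.of_injOn (f := φ) (fun x _ => hφt x) ?_ ht
    intro x hx y hy hxy
    by_contra hne
    have h1 := hSD hx hy hne
    have h2 := hφ x
    have h3 := hφ y
    rw [← hxy] at h3
    have := dist_triangle_right x y (φ x)
    linarith
  refine ⟨hfin.toFinset, by simpa using hSP, by simpa using hSD, ?_⟩
  intro x hx
  by_contra! hcon
  simp only [Finite.mem_toFinset] at hcon
  have hins : insert x S ∈ {S : Set Ω | S ⊆ P ∧ S.Pairwise (fun x y => D ≤ dist x y)} := by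
    refine ⟨insert_subset hx hSP, hSD.insert ?_⟩
    intro y hy _
    exact ⟨hcon y hy, by rw [dist_comm]; exact hcon y hy⟩
  have hxS : x ∈ S := hS.le_of_ge hins (subset_insert _ _) (mem_insert _ _)
  have := hcon x hxS
  rw [dist_self] at this
  linarith

/-! ### Measure of balls and packing counts. -/

/-- Two-sided power bounds for the measure of balls, the upper one at all radii. -/
structure BallBounds {Ω : Type*} [MetricSpace Ω] [MeasurableSpace Ω] (m : Measure Ω)
    (δ a b r₀ : ℝ) : Prop where
  δ_pos : 0 < δ
  a_pos : 0 < a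
  b_pos : 0 < b
  r₀_pos : 0 < r₀
  lower : ∀ (x : Ω) (r : ℝ), 0 < r → r ≤ r₀ → a * r ^ δ ≤ m.real (Metric.ball x r)
  upper : ∀ (x : Ω) (r : ℝ), 0 < r → m.real (Metric.ball x r) ≤ b * r ^ δ

/-- Beyond `r₀` the total mass `1 ≤ (r / r₀)^δ` serves as upper bound, which accounts for the
enlarged constant. -/
theorem PowerLaw.exists_ballBounds {Ω : Type*} [MetricSpace Ω] [MeasurableSpace Ω]
    {m : Measure Ω} [IsProbabilityMeasure m] {δ : ℝ} (h : PowerLaw m δ) :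
    ∃ a b r₀ : ℝ, BallBounds m δ a b r₀ := by
  obtain ⟨hδ, a, b, r₀, ha, hb, hr₀, h⟩ := h
  refine ⟨a, max b (r₀ ^ δ)⁻¹, r₀, hδ, ha, lt_max_of_lt_left hb, hr₀, ?_, ?_⟩
  · intro x r hr hr'
    exact (ENNReal.ofReal_le_iff_le_toReal (measure_ne_top _ _)).1 (h x r hr hr').1
  · intro x r hr
    have hrδ : 0 < r ^ δ := Real.rpow_pos_of_pos hr _
    rcases le_total r r₀ with h' | h'
    · refine (ENNReal.toReal_le_of_le_ofReal (by positivity) (h x r hr h').2).trans ?_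
      gcongr
      exact le_max_left _ _
    · have hr₀δ : 0 < r₀ ^ δ := Real.rpow_pos_of_pos hr₀ _
      calc m.real (Metric.ball x r) ≤ 1 := measureReal_le_one
        _ ≤ (r₀ ^ δ)⁻¹ * r ^ δ := by
          rw [← div_eq_inv_mul, one_le_div hr₀δ]
          exact Real.rpow_le_rpow hr₀.le h' hδ.le
        _ ≤ _ := by gcongr; exact le_max_right _ _

namespace BallBounds

variable {Ω : Type*} [MetricSpace Ω] [MeasurableSpace Ω] [OpensMeasurableSpace Ω]
  {m : Measure Ω} [IsProbabilityMeasure m] {δ a b r₀ : ℝ}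

/-- Disjoint small balls with centres in `S` contained in a set `A` of small measure: there are few
of them. -/
theorem card_mul_le (hB : BallBounds m δ a b r₀) {S : Finset Ω} {ρ : ℝ} (hρ : 0 < ρ) (hρ' : ρ ≤ r₀)
    (hS : (S : Set Ω).Pairwise (fun x y => 4 * ρ ≤ dist x y)) {A : Set Ω}
    (hA : ∀ c ∈ S, Metric.ball c ρ ⊆ A) :
    (S.card : ℝ) * (a * ρ ^ δ) ≤ m.real A := by
  have hdisj : (S : Set Ω).PairwiseDisjoint (fun c => Metric.ball c ρ) := by
    intro x hx y hy hxy
    exact Metric.ball_disjoint_ball (by linarith [hS hx hy hxy])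
  calc (S.card : ℝ) * (a * ρ ^ δ) = ∑ c ∈ S, a * ρ ^ δ := by simp
    _ ≤ ∑ c ∈ S, m.real (Metric.ball c ρ) := Finset.sum_le_sum fun c _ => hB.lower c ρ hρ hρ'
    _ = m.real (⋃ c ∈ S, Metric.ball c ρ) :=
      (measureReal_biUnion_finset hdisj fun c _ => measurableSet_ball).symm
    _ ≤ m.real A := measureReal_mono (iUnion₂_subset hA)

end BallBounds

/-! ### Level systems: the abstract form of ubiquity and the intersection conditions. -/

/-- A sequence of levels. At level `n` there is a set `Z n` of centres, each centre `c` carrying a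
piece `T n c` of the ball `B (c, ρ n / 2)`; the normalised restriction of `m` to this piece
satisfies a Frostman estimate with respect to `f`, thickenings of the piece have controlled
measure, and small thickenings of it lie in the target set `E n`. The balls `B (c, ρ n)` cover a
fixed proportion of every ball. -/
structure LevelSystem {Ω : Type*} [MetricSpace Ω] [MeasurableSpace Ω] (m : Measure Ω)
    (f : ℝ → ℝ) (δ p κ C : ℝ) (ρ t g : ℕ → ℝ) (Z : ℕ → Set Ω) (T : ℕ → Ω → Set Ω)
    (E : ℕ → Set Ω) : Prop where
  p_pos : 0 < p
  κ_pos : 0 < κ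
  C_pos : 0 < C
  ρ_pos : ∀ n, 0 < ρ n
  ρ_lim : Tendsto ρ atTop (𝓝 0)
  t_pos : ∀ n, 0 < t n
  t_le : ∀ n, t n ≤ ρ n
  g_pos : ∀ n, 0 < g n
  -- Since `t^δ = o(f t)`, this makes the volume fraction `(t / ρ)^p` of a piece negligible against
  -- `g`; summed over a block it is then small against the sum of `g`.
  ratio_le : ∀ n, (t n / ρ n) ^ p * f (t n) ≤ g n * t n ^ δ
  piece_open : ∀ n, ∀ c ∈ Z n, IsOpen (T n c)
  piece_subset : ∀ n, ∀ c ∈ Z n, T n c ⊆ Metric.ball c (ρ n / 2)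
  piece_pos : ∀ n, ∀ c ∈ Z n, 0 < m.real (T n c)
  piece_ball : ∀ n, ∀ c ∈ Z n, ∀ x r, 0 < r → r ≤ ρ n →
    m.real (Metric.ball x r ∩ T n c) * (g n * ρ n ^ δ) ≤ C * f r * m.real (T n c)
  piece_nhd : ∀ n, ∀ c ∈ Z n, ∀ w, 0 < w → w ≤ ρ n / 2 →
    m.real (Metric.thickening w (T n c)) ≤ C * ρ n ^ δ * ((t n / ρ n) ^ p + (w / ρ n) ^ p)
  piece_target : ∀ n, ∀ c ∈ Z n, Metric.thickening (t n) (T n c) ⊆ E n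
  ubiq : ∃ r₁, 0 < r₁ ∧ ∀ (x : Ω) (r : ℝ), 0 < r → r ≤ r₁ → ∀ᶠ n in atTop,
    κ * m.real (Metric.ball x r) ≤ m.real (Metric.ball x r ∩ ⋃ c ∈ Z n, Metric.ball c (ρ n))

theorem LevelSystem.comp {Ω : Type*} [MetricSpace Ω] [MeasurableSpace Ω] {m : Measure Ω}
    {f : ℝ → ℝ} {δ p κ C : ℝ} {ρ t g : ℕ → ℝ} {Z : ℕ → Set Ω} {T : ℕ → Ω → Set Ω}
    {E : ℕ → Set Ω} (h : LevelSystem m f δ p κ C ρ t g Z T E) {φ : ℕ → ℕ} (hφ : StrictMono φ) :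
    LevelSystem m f δ p κ C (ρ ∘ φ) (t ∘ φ) (g ∘ φ) (Z ∘ φ) (T ∘ φ) (E ∘ φ) where
  p_pos := h.p_pos
  κ_pos := h.κ_pos
  C_pos := h.C_pos
  ρ_pos n := h.ρ_pos _
  ρ_lim := h.ρ_lim.comp hφ.tendsto_atTop
  t_pos n := h.t_pos _
  t_le n := h.t_le _
  g_pos n := h.g_pos _
  ratio_le n := h.ratio_le _
  piece_open n := h.piece_open _
  piece_subset n := h.piece_subset _
  piece_pos n := h.piece_pos _
  piece_ball n := h.piece_ball _
  piece_nhd n := h.piece_nhd _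
  piece_target n := h.piece_target _
  ubiq := by
    obtain ⟨r₁, hr₁, hu⟩ := h.ubiq
    exact ⟨r₁, hr₁, fun x r hr hr' => hφ.tendsto_atTop.eventually (hu x r hr hr')⟩

/-- Ubiquity is applied to the half ball, so that the centres found stay within `3s/4` and their
balls inside `B(x₀, s)`. For a maximal `4 ρ n`-separated set of centres the balls of radius `5 ρ n`
cover the ubiquitous part, while those of radius `ρ n` are disjoint; `10^δ` is `2^δ * 5^δ`. -/
theorem LevelSystem.exists_packing {Ω : Type*} [MetricSpace Ω] [CompactSpace Ω]
    [MeasurableSpace Ω] [OpensMeasurableSpace Ω] {m : Measure Ω} [IsProbabilityMeasure m]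
    {f : ℝ → ℝ} {δ p κ C a b r₀ : ℝ} {ρ t g : ℕ → ℝ} {Z : ℕ → Set Ω} {T : ℕ → Ω → Set Ω}
    {E : ℕ → Set Ω} (h : LevelSystem m f δ p κ C ρ t g Z T E) (hB : BallBounds m δ a b r₀)
    {x₀ : Ω} {s : ℝ} (hs : 0 < s) (hs' : s ≤ r₀) {n : ℕ} (hn : ρ n ≤ s / 4)
    (hu : κ * m.real (Metric.ball x₀ (s / 2)) ≤
      m.real (Metric.ball x₀ (s / 2) ∩ ⋃ c ∈ Z n, Metric.ball c (ρ n))) :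
    ∃ S : Finset Ω, (∀ c ∈ S, c ∈ Z n ∧ dist c x₀ < 3 * s / 4) ∧
      (S : Set Ω).Pairwise (fun x y => 4 * ρ n ≤ dist x y) ∧
      κ * a / (b * 10 ^ δ) * s ^ δ ≤ S.card * ρ n ^ δ ∧
      S.card * ρ n ^ δ ≤ b / a * s ^ δ := by
  have hρ := h.ρ_pos n
  have ha := hB.a_pos
  have hb := hB.b_pos
  have hκ := h.κ_pos
  obtain ⟨S, hSP, hSD, hnet⟩ := exists_finset_separated_net
    {c | c ∈ Z n ∧ dist c x₀ < 3 * s / 4} (D := 4 * ρ n) (by positivity)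
  refine ⟨S, fun c hc => hSP hc, hSD, ?_, ?_⟩
  · have hsub : Metric.ball x₀ (s / 2) ∩ ⋃ c ∈ Z n, Metric.ball c (ρ n) ⊆
        ⋃ c ∈ S, Metric.ball c (5 * ρ n) := by
      rintro z ⟨hz, hz'⟩
      simp only [mem_iUnion, exists_prop, Metric.mem_ball] at hz hz' ⊢
      obtain ⟨c, hc, hzc⟩ := hz'
      have h1 : dist c x₀ < 3 * s / 4 := by
        have := dist_triangle_left c x₀ z
        linarith
      obtain ⟨y, hy, hcy⟩ := hnet c ⟨hc, h1⟩
      exact ⟨y, hy, by linarith [dist_triangle z c y]⟩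
    have h1 : κ * (a * (s / 2) ^ δ) ≤ S.card * (b * (5 * ρ n) ^ δ) :=
      calc κ * (a * (s / 2) ^ δ) ≤ κ * m.real (Metric.ball x₀ (s / 2)) := by
            gcongr
            exact hB.lower _ _ (by positivity) (by linarith)
        _ ≤ m.real (⋃ c ∈ S, Metric.ball c (5 * ρ n)) := hu.trans (measureReal_mono hsub (measure_ne_top _ _))
        _ ≤ ∑ c ∈ S, m.real (Metric.ball c (5 * ρ n)) := measureReal_biUnion_finset_le _ _
        _ ≤ ∑ c ∈ S, b * (5 * ρ n) ^ δ :=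
            Finset.sum_le_sum fun c _ => hB.upper c _ (by positivity)
        _ = S.card * (b * (5 * ρ n) ^ δ) := by simp
    rw [Real.div_rpow hs.le (by norm_num), Real.mul_rpow (by norm_num) hρ.le] at h1
    have h10 : (10 : ℝ) ^ δ = 2 ^ δ * 5 ^ δ := by
      rw [← Real.mul_rpow (by norm_num) (by norm_num)]; norm_num
    have h2 : (0 : ℝ) < 2 ^ δ := by positivity
    have h5 : (0 : ℝ) < 5 ^ δ := by positivity
    rw [h10, div_mul_eq_mul_div, div_le_iff₀ (by positivity)]
    have h3 := mul_le_mul_of_nonneg_right h1 h2.le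
    have h4 : κ * (a * (s ^ δ / 2 ^ δ)) * 2 ^ δ = κ * a * s ^ δ := by field_simp
    rw [h4] at h3
    linarith
  · have h1 : (S.card : ℝ) * (a * ρ n ^ δ) ≤ b * s ^ δ := by
      refine (hB.card_mul_le hρ (by linarith) hSD (A := Metric.ball x₀ s) ?_).trans
        (hB.upper _ _ hs)
      intro c hc
      refine Metric.ball_subset_ball' ?_
      have := (hSP hc).2
      linarith
    rw [div_mul_eq_mul_div, le_div_iff₀ ha]
    linarith

/-! ### Lacunary sums and blocks of divergent series. -/

/-- In a sufficiently lacunary sequence, each term is negligible relative to all earlier ones. -/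
theorem exists_lacunary_sum_le {p ζ : ℝ} (hp : 0 < p) (hζ : 0 < ζ) :
    ∃ θ : ℝ, 0 < θ ∧ θ ≤ 1 / 8 ∧ ∀ ρ : ℕ → ℝ, (∀ n, 0 < ρ n) → (∀ n, ρ (n + 1) ≤ θ * ρ n) →
      ∀ N k, ∑ i ∈ Finset.Ico N k, (4 * ρ k / ρ i) ^ p ≤ ζ := by
  have h4 : (0 : ℝ) < 4 ^ p := by positivity
  -- Passing from `k` to `k + 1` replaces a sum `Σ` by at most `θ^p (Σ + 4^p)`; `q` solves `q (ζ +
  -- 4^p) = ζ`, so the bound `ζ` reproduces itself.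
  set q : ℝ := ζ / (ζ + 4 ^ p) with hq
  have hq0 : 0 < q := by positivity
  refine ⟨min (1 / 8) (q ^ p⁻¹), by positivity, min_le_left _ _, ?_⟩
  set θ := min (1 / 8) (q ^ p⁻¹) with hθ
  have hθ0 : 0 < θ := by positivity
  have hθp : θ ^ p ≤ q := by
    calc θ ^ p ≤ (q ^ p⁻¹) ^ p := Real.rpow_le_rpow hθ0.le (min_le_right _ _) hp.le
      _ = q := Real.rpow_inv_rpow hq0.le hp.ne'
  intro ρ hρ hlac N k
  induction k with
  | zero => simpa using hζ.le
  | succ k ih =>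
    rcases lt_or_ge k N with hk | hk
    · rw [Finset.Ico_eq_empty (by omega)]
      simpa using hζ.le
    · rw [Finset.sum_Ico_succ_top hk]
      have hterm : ∀ i, (4 * ρ (k + 1) / ρ i) ^ p ≤ θ ^ p * (4 * ρ k / ρ i) ^ p := by
        intro i
        have h1 := hρ i
        have h2 := hρ k
        have h3 := hρ (k + 1)
        rw [← Real.mul_rpow hθ0.le (by positivity)]
        refine Real.rpow_le_rpow (by positivity) ?_ hp.le
        rw [← mul_div_assoc]
        gcongr ?_ / _
        linarith [hlac k]
      have hlast : (4 * ρ k / ρ k) ^ p = 4 ^ p := by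
        rw [mul_div_assoc, div_self (hρ k).ne', mul_one]
      calc ∑ i ∈ Finset.Ico N k, (4 * ρ (k + 1) / ρ i) ^ p + (4 * ρ (k + 1) / ρ k) ^ p
          ≤ ∑ i ∈ Finset.Ico N k, θ ^ p * (4 * ρ k / ρ i) ^ p + θ ^ p * (4 * ρ k / ρ k) ^ p :=
            add_le_add (Finset.sum_le_sum fun i _ => hterm i) (hterm k)
        _ = θ ^ p * (∑ i ∈ Finset.Ico N k, (4 * ρ k / ρ i) ^ p + 4 ^ p) := by
            rw [hlast, mul_add, Finset.mul_sum]
        _ ≤ q * (ζ + 4 ^ p) := by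
            have hnn : 0 ≤ ∑ i ∈ Finset.Ico N k, (4 * ρ k / ρ i) ^ p :=
              Finset.sum_nonneg fun i _ => Real.rpow_nonneg
                (div_nonneg (mul_nonneg (by norm_num) (hρ k).le) (hρ i).le) _
            gcongr
        _ = ζ := by rw [hq]; field_simp

/-- A divergent series of positive terms has blocks whose sums just exceed any given bound. -/
theorem exists_block {g : ℕ → ℝ} (hg : ∀ n, 0 < g n) (hsum : ¬ Summable g) {K : ℝ} (hK : 0 < K)
    (N : ℕ) : ∃ M, N ≤ M ∧ ∑ i ∈ Finset.Ico N M, g i < K ∧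
      K ≤ ∑ i ∈ Finset.Ico N (M + 1), g i := by
  have htend := (not_summable_iff_tendsto_nat_atTop_of_nonneg fun n => (hg n).le).1 hsum
  have hex : ∃ n, K ≤ ∑ i ∈ Finset.Ico N (n + 1), g i := by
    have h1 := (htend.comp (tendsto_add_atTop_nat 1)).eventually_ge_atTop
      (K + ∑ i ∈ Finset.range N, g i)
    obtain ⟨n, hn, hnN⟩ := (h1.and (eventually_ge_atTop N)).exists
    refine ⟨n, ?_⟩
    rw [Finset.sum_Ico_eq_sub _ (by omega)]
    simp only [Function.comp_apply] at hn
    linarith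
  classical
  have hM := Nat.find_spec hex
  have hMmin := fun n => Nat.find_min hex (m := n)
  set M := Nat.find hex
  have hNM : N ≤ M := by
    by_contra! hlt
    rw [Finset.Ico_eq_empty (by omega)] at hM
    simp only [Finset.sum_empty] at hM
    linarith
  refine ⟨M, hNM, ?_, hM⟩
  rcases Nat.eq_zero_or_pos M with h0 | h0
  · rw [Finset.Ico_eq_empty (by omega)]
    simpa using hK
  · have := hMmin (M - 1) (by omega)
    rw [Nat.sub_add_cancel h0] at this
    exact not_le.1 this

/-- Only the last term can exceed `K`, the earlier ones being dominated by a partial sum below `K`.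
Truncation thus tames the overshoot when `g` is unbounded. -/
theorem sum_min_bounds {g : ℕ → ℝ} (hg : ∀ n, 0 < g n) {K : ℝ} {N M : ℕ}
    (hNM : N ≤ M) (h1 : ∑ i ∈ Finset.Ico N M, g i < K)
    (h2 : K ≤ ∑ i ∈ Finset.Ico N (M + 1), g i) :
    K ≤ ∑ i ∈ Finset.Ico N (M + 1), min (g i) K ∧
      ∑ i ∈ Finset.Ico N (M + 1), min (g i) K ≤ 2 * K := by
  rw [Finset.sum_Ico_succ_top hNM] at h2 ⊢
  have hsmall : ∑ i ∈ Finset.Ico N M, min (g i) K = ∑ i ∈ Finset.Ico N M, g i := by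
    refine Finset.sum_congr rfl fun i hi => min_eq_left ?_
    exact (Finset.single_le_sum (f := g) (fun j _ => (hg j).le) hi).trans h1.le
  have hnn : 0 ≤ ∑ i ∈ Finset.Ico N M, g i := Finset.sum_nonneg fun j _ => (hg j).le
  rw [hsmall]
  refine ⟨?_, by linarith [min_le_right (g M) K]⟩
  rcases min_cases (g M) K with ⟨h, -⟩ | ⟨h, -⟩ <;> rw [h] <;> linarith

/-! ### Separation of pieces and mass of balls within a block of levels. -/

section Block

variable {Ω : Type*} [MetricSpace Ω] [MeasurableSpace Ω] [OpensMeasurableSpace Ω] {m : Measure Ω}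
  [IsProbabilityMeasure m] {f : ℝ → ℝ} {δ p κ C a b r₀ : ℝ} {ρ t g : ℕ → ℝ} {Z : ℕ → Set Ω}
  {T : ℕ → Ω → Set Ω} {E : ℕ → Set Ω}

/-- The centres at level `k` whose `3 ρ k`-ball avoids all pieces of the levels `N, …, k - 1`. -/
noncomputable def goodCentres (ρ : ℕ → ℝ) (T : ℕ → Ω → Set Ω) (S : ℕ → Finset Ω) (N k : ℕ) :
    Finset Ω :=
  open Classical in
  (S k).filter fun c => ∀ i ∈ Finset.Ico N k, ∀ c' ∈ S i,
    Disjoint (Metric.ball c (3 * ρ k)) (T i c')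

theorem goodCentres_subset (ρ : ℕ → ℝ) (T : ℕ → Ω → Set Ω) (S : ℕ → Finset Ω) (N k : ℕ) :
    goodCentres ρ T S N k ⊆ S k := by
  classical
  exact Finset.filter_subset _ _

/-- The `ρ k`-ball around a bad centre lies in the `4 ρ k`-neighbourhood of an earlier piece. These
balls are disjoint, so the measure of the neighbourhoods, at most `2 C ζ (b / a) s^δ`, bounds their
number; `hζ` makes this at most half of the guaranteed count. -/
theorem LevelSystem.le_card_goodCentres (h : LevelSystem m f δ p κ C ρ t g Z T E)
    (hB : BallBounds m δ a b r₀) {S : ℕ → Finset Ω} {N k : ℕ} {s c₃ ζ : ℝ} (hs : 0 < s)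
    (hSZ : ∀ i, N ≤ i → i ≤ k → ∀ c ∈ S i, c ∈ Z i)
    (hSsep : (S k : Set Ω).Pairwise (fun x y => 4 * ρ k ≤ dist x y))
    (hSlow : c₃ * s ^ δ ≤ (S k).card * ρ k ^ δ)
    (hSup : ∀ i, N ≤ i → i ≤ k → (S i).card * ρ i ^ δ ≤ b / a * s ^ δ)
    (hρ₀ : ρ k ≤ r₀) (hlac : ∀ i ∈ Finset.Ico N k, ρ k ≤ ρ i / 8)
    (hsum₁ : ∑ i ∈ Finset.Ico N k, (t i / ρ i) ^ p ≤ ζ)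
    (hsum₂ : ∑ i ∈ Finset.Ico N k, (4 * ρ k / ρ i) ^ p ≤ ζ)
    (hζ : 4 * C * b * ζ ≤ c₃ * a ^ 2) :
    c₃ / 2 * s ^ δ ≤ (goodCentres ρ T S N k).card * ρ k ^ δ := by
  classical
  have ha := hB.a_pos
  have hb := hB.b_pos
  have hC := h.C_pos
  have hρk := h.ρ_pos k
  set bad : Finset Ω := (S k).filter fun c => ¬ ∀ i ∈ Finset.Ico N k, ∀ c' ∈ S i,
    Disjoint (Metric.ball c (3 * ρ k)) (T i c') with hbad
  have hcard : (S k).card = (goodCentres ρ T S N k).card + bad.card := by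
    rw [hbad, goodCentres, Finset.card_filter_add_card_filter_not]
  have hbadsub : ∀ c ∈ bad, Metric.ball c (ρ k) ⊆
      ⋃ i ∈ Finset.Ico N k, ⋃ c' ∈ S i, Metric.thickening (4 * ρ k) (T i c') := by
    intro c hc y hy
    simp only [hbad, Finset.mem_filter, not_forall, Set.not_disjoint_iff] at hc
    obtain ⟨-, i, hi, c', hc', z, hz, hzT⟩ := hc
    simp only [mem_iUnion]
    refine ⟨i, hi, c', hc', Metric.mem_thickening_iff.2 ⟨z, hzT, ?_⟩⟩
    rw [Metric.mem_ball] at hy hz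
    have := dist_triangle_right y z c
    linarith
  have h1 : (bad.card : ℝ) * (a * ρ k ^ δ) ≤ C * (b / a * s ^ δ) * (2 * ζ) := by
    calc (bad.card : ℝ) * (a * ρ k ^ δ)
        ≤ m.real (⋃ i ∈ Finset.Ico N k, ⋃ c' ∈ S i, Metric.thickening (4 * ρ k) (T i c')) :=
          hB.card_mul_le hρk hρ₀ (hSsep.mono (Finset.coe_subset.2 (Finset.filter_subset _ _)))
            hbadsub
      _ ≤ ∑ i ∈ Finset.Ico N k, m.real (⋃ c' ∈ S i, Metric.thickening (4 * ρ k) (T i c')) :=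
          measureReal_biUnion_finset_le _ _
      _ ≤ ∑ i ∈ Finset.Ico N k, C * (b / a * s ^ δ) *
            ((t i / ρ i) ^ p + (4 * ρ k / ρ i) ^ p) := by
          refine Finset.sum_le_sum fun i hi => ?_
          have hi' := Finset.mem_Ico.1 hi
          have hρi := h.ρ_pos i
          have hti := h.t_pos i
          calc m.real (⋃ c' ∈ S i, Metric.thickening (4 * ρ k) (T i c'))
              ≤ ∑ c' ∈ S i, m.real (Metric.thickening (4 * ρ k) (T i c')) :=
                measureReal_biUnion_finset_le _ _
            _ ≤ ∑ c' ∈ S i, C * ρ i ^ δ * ((t i / ρ i) ^ p + (4 * ρ k / ρ i) ^ p) :=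
                Finset.sum_le_sum fun c' hc' => h.piece_nhd i c' (hSZ i hi'.1 hi'.2.le c' hc') _
                  (by positivity) (by linarith [hlac i hi])
            _ = C * ((S i).card * ρ i ^ δ) * ((t i / ρ i) ^ p + (4 * ρ k / ρ i) ^ p) := by
                rw [Finset.sum_const, nsmul_eq_mul]; ring
            _ ≤ _ := by
                have := h.ρ_pos k
                exact mul_le_mul_of_nonneg_right
                  (mul_le_mul_of_nonneg_left (hSup i hi'.1 hi'.2.le) hC.le) (by positivity)
      _ = C * (b / a * s ^ δ) *
            (∑ i ∈ Finset.Ico N k, (t i / ρ i) ^ p + ∑ i ∈ Finset.Ico N k, (4 * ρ k / ρ i) ^ p) := by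
          rw [← Finset.mul_sum, Finset.sum_add_distrib]
      _ ≤ _ := by
          gcongr
          linarith
  have h2 : (bad.card : ℝ) * ρ k ^ δ ≤ c₃ / 2 * s ^ δ := by
    have hsδ : 0 < s ^ δ := Real.rpow_pos_of_pos hs _
    have h3 : a * ((bad.card : ℝ) * ρ k ^ δ) ≤ a * (c₃ / 2 * s ^ δ) := by
      calc a * ((bad.card : ℝ) * ρ k ^ δ) = (bad.card : ℝ) * (a * ρ k ^ δ) := by ring
        _ ≤ C * (b / a * s ^ δ) * (2 * ζ) := h1
        _ = (4 * C * b * ζ) * (s ^ δ / (2 * a)) := by field_simp; ring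
        _ ≤ (c₃ * a ^ 2) * (s ^ δ / (2 * a)) := by gcongr
        _ = a * (c₃ / 2 * s ^ δ) := by field_simp
    exact le_of_mul_le_mul_left h3 ha
  have hcard' : ((S k).card : ℝ) = (goodCentres ρ T S N k).card + bad.card := by
    exact_mod_cast hcard
  rw [hcard', add_mul] at hSlow
  linarith

/-- The mass given to `B` by the restriction of `m` to a piece, normalised to mass `ρ k ^ δ`. -/
noncomputable def pieceMass (m : Measure Ω) (δ : ℝ) (ρ : ℕ → ℝ) (T : ℕ → Ω → Set Ω) (k : ℕ) (c : Ω)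
    (B : Set Ω) : ℝ :=
  ρ k ^ δ * (m.real (B ∩ T k c) / m.real (T k c))

theorem LevelSystem.pieceMass_nonneg (h : LevelSystem m f δ p κ C ρ t g Z T E) (k : ℕ) (c : Ω)
    (B : Set Ω) : 0 ≤ pieceMass m δ ρ T k c B := by
  have := h.ρ_pos k
  unfold pieceMass
  positivity

theorem LevelSystem.pieceMass_le (h : LevelSystem m f δ p κ C ρ t g Z T E) {k : ℕ} {c : Ω}
    (hc : c ∈ Z k) (B : Set Ω) : pieceMass m δ ρ T k c B ≤ ρ k ^ δ := by
  have h1 := h.ρ_pos k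
  have h2 := h.piece_pos k c hc
  unfold pieceMass
  refine mul_le_of_le_one_right (by positivity) ?_
  rw [div_le_one h2]
  exact measureReal_mono inter_subset_right

theorem LevelSystem.pieceMass_univ (h : LevelSystem m f δ p κ C ρ t g Z T E) {k : ℕ} {c : Ω}
    (hc : c ∈ Z k) : pieceMass m δ ρ T k c univ = ρ k ^ δ := by
  unfold pieceMass
  rw [univ_inter, div_self (h.piece_pos k c hc).ne', mul_one]

theorem LevelSystem.mul_pieceMass_le (h : LevelSystem m f δ p κ C ρ t g Z T E) {k : ℕ} {c : Ω}
    (hc : c ∈ Z k) {x : Ω} {r : ℝ} (hr : 0 < r) (hr' : r ≤ ρ k) :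
    g k * pieceMass m δ ρ T k c (Metric.ball x r) ≤ C * f r := by
  have h2 := h.piece_pos k c hc
  have h3 := h.piece_ball k c hc x r hr hr'
  unfold pieceMass
  rw [← mul_assoc, ← mul_div_assoc, div_le_iff₀ h2]
  linarith

/-- At scales `r ≥ ρ k` a level looks like `m`: only centres within `2r` contribute, each at most `ρ
k ^ δ`, and a volume count bounds their number. -/
theorem LevelSystem.sum_pieceMass_le (h : LevelSystem m f δ p κ C ρ t g Z T E)
    (hB : BallBounds m δ a b r₀) {k : ℕ} {S : Finset Ω} (hSZ : ∀ c ∈ S, c ∈ Z k)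
    (hSsep : (S : Set Ω).Pairwise (fun x y => 4 * ρ k ≤ dist x y)) (hρ₀ : ρ k ≤ r₀)
    {x : Ω} {r : ℝ} (hr : ρ k ≤ r) :
    ∑ c ∈ S, pieceMass m δ ρ T k c (Metric.ball x r) ≤ b * 3 ^ δ / a * r ^ δ := by
  classical
  have hρ := h.ρ_pos k
  have ha := hB.a_pos
  have hr0 : 0 < r := hρ.trans_le hr
  set S' := S.filter fun c => dist c x < 2 * r with hS'
  have hzero : ∀ c ∈ S, c ∉ S' → pieceMass m δ ρ T k c (Metric.ball x r) = 0 := by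
    intro c hc hcS'
    have hfar : 2 * r ≤ dist c x := by
      by_contra! hlt
      exact hcS' (Finset.mem_filter.2 ⟨hc, hlt⟩)
    have hempty : Metric.ball x r ∩ T k c = ∅ := by
      refine eq_empty_of_forall_notMem fun z hz => ?_
      have h1 := hz.1
      have h2 := h.piece_subset k c (hSZ c hc) hz.2
      rw [Metric.mem_ball] at h1 h2
      have := dist_triangle_left c x z
      linarith
    simp [pieceMass, hempty]
  have hcard : (S'.card : ℝ) * (a * ρ k ^ δ) ≤ b * (3 * r) ^ δ := by
    refine (hB.card_mul_le hρ hρ₀ (hSsep.mono (Finset.coe_subset.2 (Finset.filter_subset _ _)))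
      (A := Metric.ball x (3 * r)) ?_).trans (hB.upper _ _ (by positivity))
    intro c hc
    refine Metric.ball_subset_ball' ?_
    have := (Finset.mem_filter.1 hc).2
    linarith
  calc ∑ c ∈ S, pieceMass m δ ρ T k c (Metric.ball x r)
      = ∑ c ∈ S', pieceMass m δ ρ T k c (Metric.ball x r) :=
        (Finset.sum_subset (Finset.filter_subset _ _) hzero).symm
    _ ≤ ∑ c ∈ S', ρ k ^ δ := Finset.sum_le_sum fun c hc =>
        h.pieceMass_le (hSZ c (Finset.filter_subset _ _ hc)) _
    _ = S'.card * ρ k ^ δ := by simp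
    _ ≤ _ := by
        rw [Real.mul_rpow (by norm_num) hr0.le] at hcard
        rw [div_mul_eq_mul_div, le_div_iff₀ ha]
        linarith

/-- The total weighted mass which a block of levels gives to a ball. -/
theorem LevelSystem.sum_sum_pieceMass_le (h : LevelSystem m f δ p κ C ρ t g Z T E)
    (hB : BallBounds m δ a b r₀) {S : ℕ → Finset Ω} {N M : ℕ} {w : ℕ → ℝ}
    (hSZ : ∀ k ∈ Finset.Ico N M, ∀ c ∈ S k, c ∈ Z k)
    (hSsep : ∀ k ∈ Finset.Ico N M, (S k : Set Ω).Pairwise (fun x y => 4 * ρ k ≤ dist x y))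
    (hρ₀ : ∀ k ∈ Finset.Ico N M, ρ k ≤ r₀) (hw : ∀ k, 0 ≤ w k) (hwg : ∀ k, w k ≤ g k)
    (hf : ∀ r, 0 < r → 0 < f r)
    {x : Ω} {r : ℝ} (hr : 0 < r) :
    ∑ k ∈ Finset.Ico N M, ∑ c ∈ goodCentres ρ T S N k,
        w k * pieceMass m δ ρ T k c (Metric.ball x r) ≤
      C * f r + (∑ k ∈ Finset.Ico N M, w k) * (b * 3 ^ δ / a * r ^ δ) := by
  classical
  have ha := hB.a_pos
  have hb := hB.b_pos
  have hG := goodCentres_subset ρ T S N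
  set F : (Σ _ : ℕ, Ω) → ℝ := fun q => w q.1 * pieceMass m δ ρ T q.1 q.2 (Metric.ball x r)
    with hF
  have hF0 : ∀ q, 0 ≤ F q := fun q => mul_nonneg (hw _) (h.pieceMass_nonneg _ _ _)
  have hmeet : ∀ q : (Σ _ : ℕ, Ω), F q ≠ 0 → ∃ z ∈ Metric.ball x r, z ∈ T q.1 q.2 := by
    intro q hq
    by_contra! hcon
    refine hq ?_
    have : Metric.ball x r ∩ T q.1 q.2 = ∅ := by
      ext z
      simpa using hcon z
    simp [hF, pieceMass, this]
  -- Among the levels with `ρ k > r` the ball meets at most one piece. Two pieces of one level would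
  -- have centres less than `3 ρ k` apart; for two levels, the earlier piece would enter the `3 ρ
  -- k'`-ball of a good centre of the later level `k'`. So the double sum has at most one nonzero
  -- term.
  have hsmall : ∑ q ∈ ((Finset.Ico N M).filter fun k => r < ρ k).sigma
      (fun k => goodCentres ρ T S N k), F q ≤ C * f r := by
    have hsingle : ∀ q : (Σ _ : ℕ, Ω), q ∈ ((Finset.Ico N M).filter fun k => r < ρ k).sigma
        (fun k => goodCentres ρ T S N k) → ∀ q' : (Σ _ : ℕ, Ω),
        q' ∈ ((Finset.Ico N M).filter fun k => r < ρ k).sigma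
        (fun k => goodCentres ρ T S N k) → F q ≠ 0 → F q' ≠ 0 → q.1 ≤ q'.1 → q = q' := by
      rintro ⟨k, c⟩ hq ⟨k', c'⟩ hq' hFq hFq' hkk'
      obtain ⟨z, hzB, hzT⟩ := hmeet _ hFq
      obtain ⟨z', hzB', hzT'⟩ := hmeet _ hFq'
      simp only [Finset.mem_sigma, Finset.mem_filter] at hq hq'
      obtain ⟨⟨hk, hrk⟩, hc⟩ := hq
      obtain ⟨⟨hk', hrk'⟩, hc'⟩ := hq'
      have hz1 := h.piece_subset k c (hSZ k hk c (hG k hc)) hzT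
      have hz2 := h.piece_subset k' c' (hSZ k' hk' c' (hG k' hc')) hzT'
      rw [Metric.mem_ball] at hz1 hz2 hzB hzB'
      simp only at hkk' hzT hzT'
      rcases hkk'.eq_or_lt with heq | hlt
      · subst heq
        have : c = c' := by
          by_contra hne
          have h1 := hSsep k hk (hG k hc) (hG k hc') hne
          have h2 := dist_triangle4 c z x c'
          have h3 := dist_triangle x z' c'
          rw [dist_comm c z] at h2
          rw [dist_comm x z'] at h3
          linarith
        rw [this]
      · exfalso
        have hdisj := (Finset.mem_filter.1 hc').2 k
          (Finset.mem_Ico.2 ⟨(Finset.mem_Ico.1 hk).1, hlt⟩) c (hG k hc)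
        refine Set.disjoint_left.1 hdisj (Metric.mem_ball.2 ?_) hzT
        have h2 := dist_triangle4 z x z' c'
        rw [dist_comm x z'] at h2
        linarith
    by_cases hex : ∃ q ∈ ((Finset.Ico N M).filter fun k => r < ρ k).sigma
        (fun k => goodCentres ρ T S N k), F q ≠ 0
    · obtain ⟨q, hq, hFq⟩ := hex
      rw [Finset.sum_eq_single_of_mem q hq]
      · simp only [Finset.mem_sigma, Finset.mem_filter] at hq
        have hqZ := hSZ q.1 hq.1.1 q.2 (hG _ hq.2)
        refine le_trans ?_ (h.mul_pieceMass_le hqZ hr hq.1.2.le (x := x))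
        exact mul_le_mul_of_nonneg_right (hwg _) (h.pieceMass_nonneg _ _ _)
      · intro q' hq' hne
        by_contra hF'
        rcases le_total q.1 q'.1 with hle | hle
        · exact hne (hsingle q hq q' hq' hFq hF' hle).symm
        · exact hne (hsingle q' hq' q hq hF' hFq hle)
    · push Not at hex
      rw [Finset.sum_eq_zero hex]
      exact mul_nonneg h.C_pos.le (hf r hr).le
  have hlarge : ∑ k ∈ (Finset.Ico N M).filter (fun k => ¬ r < ρ k), ∑ c ∈ goodCentres ρ T S N k,
      F ⟨k, c⟩ ≤ (∑ k ∈ Finset.Ico N M, w k) * (b * 3 ^ δ / a * r ^ δ) := by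
    calc ∑ k ∈ (Finset.Ico N M).filter (fun k => ¬ r < ρ k), ∑ c ∈ goodCentres ρ T S N k, F ⟨k, c⟩
        ≤ ∑ k ∈ (Finset.Ico N M).filter (fun k => ¬ r < ρ k), w k * (b * 3 ^ δ / a * r ^ δ) := by
          refine Finset.sum_le_sum fun k hk => ?_
          obtain ⟨hk, hrk⟩ := Finset.mem_filter.1 hk
          simp only [hF, ← Finset.mul_sum]
          refine mul_le_mul_of_nonneg_left ?_ (hw k)
          exact h.sum_pieceMass_le hB (fun c hc => hSZ k hk c (hG k hc))
            ((hSsep k hk).mono (Finset.coe_subset.2 (hG k))) (hρ₀ k hk) (not_lt.1 hrk)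
      _ ≤ ∑ k ∈ Finset.Ico N M, w k * (b * 3 ^ δ / a * r ^ δ) :=
          Finset.sum_le_sum_of_subset_of_nonneg (Finset.filter_subset _ _) fun k _ _ =>
            mul_nonneg (hw k) (by positivity)
      _ = _ := by rw [Finset.sum_mul]
  rw [← Finset.sum_filter_add_sum_filter_not (Finset.Ico N M) (fun k => r < ρ k)]
  rw [Finset.sum_sigma] at hsmall
  exact add_le_add hsmall hlarge

end Block

theorem exists_forall_rpow_le {f : ℝ → ℝ} {δ : ℝ}
    (hf : Tendsto (fun r : ℝ => r ^ (-δ) * f r) (𝓝[>] 0) atTop) {ω : ℝ} (hω : 0 < ω) :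
    ∃ s : ℝ, 0 < s ∧ ∀ r, 0 < r → r ≤ s → r ^ δ ≤ ω * f r := by
  have h1 := hf.eventually_ge_atTop ω⁻¹
  obtain ⟨s, hs, hs'⟩ := (mem_nhdsGT_iff_exists_Ioc_subset).1 h1
  refine ⟨s, hs, fun r hr hrs => ?_⟩
  have h2 : ω⁻¹ ≤ r ^ (-δ) * f r := hs' ⟨hr, hrs⟩
  have hrδ : 0 < r ^ δ := Real.rpow_pos_of_pos hr _
  rw [Real.rpow_neg hr.le, inv_mul_eq_div, le_div_iff₀ hrδ, inv_mul_eq_div, div_le_iff₀ hω] at h2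
  linarith

/-! ### Local measures with a small Frostman constant. -/

section Local

variable {Ω : Type*} [MetricSpace Ω] [MeasurableSpace Ω] [OpensMeasurableSpace Ω] {m : Measure Ω}
  [IsProbabilityMeasure m] {f : ℝ → ℝ} {δ p κ C a b r₀ : ℝ} {ρ t g : ℕ → ℝ} {Z : ℕ → Set Ω}
  {T : ℕ → Ω → Set Ω} {E : ℕ → Set Ω}

/-- The weighted sum of the normalised restrictions of `m` to a finite family of pieces. -/
noncomputable def blockMeasure (m : Measure Ω) (δ : ℝ) (ρ : ℕ → ℝ) (T : ℕ → Ω → Set Ω)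
    (w : ℕ → ℝ) (I : Finset ℕ) (G : ℕ → Finset Ω) : Measure Ω :=
  ∑ k ∈ I, ∑ c ∈ G k, ENNReal.ofReal (w k * ρ k ^ δ / m.real (T k c)) • m.restrict (T k c)

theorem LevelSystem.blockMeasure_apply (h : LevelSystem m f δ p κ C ρ t g Z T E) {w : ℕ → ℝ}
    (hw : ∀ k, 0 ≤ w k) (I : Finset ℕ) (G : ℕ → Finset Ω) {B : Set Ω} (hB : MeasurableSet B) :
    blockMeasure m δ ρ T w I G B =
      ENNReal.ofReal (∑ k ∈ I, ∑ c ∈ G k, w k * pieceMass m δ ρ T k c B) := by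
  have hnn : ∀ k c, 0 ≤ w k * pieceMass m δ ρ T k c B := fun k c =>
    mul_nonneg (hw k) (h.pieceMass_nonneg k c B)
  unfold blockMeasure
  rw [Measure.finsetSum_apply, ENNReal.ofReal_sum_of_nonneg
    fun k _ => Finset.sum_nonneg fun c _ => hnn k c]
  refine Finset.sum_congr rfl fun k _ => ?_
  rw [Measure.finsetSum_apply, ENNReal.ofReal_sum_of_nonneg fun c _ => hnn k c]
  refine Finset.sum_congr rfl fun c _ => ?_
  have hρ := h.ρ_pos k
  have hwk := hw k
  rw [Measure.smul_apply, Measure.restrict_apply hB, smul_eq_mul, ← ofReal_measureReal,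
    ← ENNReal.ofReal_mul (by positivity)]
  congr 1
  unfold pieceMass
  ring

/-- Bounded density lets the next stage of the global construction control balls at small scales. -/
theorem blockMeasure_le (w : ℕ → ℝ) (I : Finset ℕ) (G : ℕ → Finset Ω) :
    ∃ H : ENNReal, H ≠ ⊤ ∧ blockMeasure m δ ρ T w I G ≤ H • m := by
  refine ⟨∑ k ∈ I, ∑ c ∈ G k, ENNReal.ofReal (w k * ρ k ^ δ / m.real (T k c)), ?_, ?_⟩
  · simp [ENNReal.sum_eq_top]
  · unfold blockMeasure
    simp_rw [Finset.sum_smul]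
    refine Finset.sum_le_sum fun k _ => Finset.sum_le_sum fun c _ => ?_
    refine Measure.le_iff.2 fun B hB => ?_
    simp only [Measure.smul_apply, smul_eq_mul]
    gcongr
    exact Measure.restrict_le_self

theorem blockMeasure_compl (w : ℕ → ℝ) (I : Finset ℕ) (G : ℕ → Finset Ω)
    (hT : ∀ k ∈ I, ∀ c ∈ G k, MeasurableSet (T k c)) :
    blockMeasure m δ ρ T w I G (⋃ k ∈ I, ⋃ c ∈ G k, T k c)ᶜ = 0 := by
  unfold blockMeasure
  rw [Measure.finsetSum_apply]
  refine Finset.sum_eq_zero fun k hk => ?_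
  rw [Measure.finsetSum_apply]
  refine Finset.sum_eq_zero fun c hc => ?_
  rw [Measure.smul_apply, Measure.restrict_apply' (hT k hk c hc)]
  have : (⋃ k ∈ I, ⋃ c ∈ G k, T k c)ᶜ ∩ T k c = ∅ := by
    refine eq_empty_of_forall_notMem fun z hz => hz.1 ?_
    exact mem_iUnion₂_of_mem hk (mem_iUnion₂_of_mem hc hz.2)
  rw [this, measure_empty, smul_zero]

/-- Every small ball carries a probability measure of bounded density, living on the target sets of
arbitrarily high levels, which satisfies a strong Frostman estimate. -/
theorem LevelSystem.exists_local_measure [CompactSpace Ω]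
    (h : LevelSystem m f δ p κ C ρ t g Z T E) (hB : BallBounds m δ a b r₀)
    (hf : ∀ r, 0 < r → 0 < f r) (hf_mono : MonotoneOn f (Ioi 0))
    (hfδ : Tendsto (fun r : ℝ => r ^ (-δ) * f r) (𝓝[>] 0) atTop)
    {θ ζ : ℝ} (hθ : θ ≤ 1 / 8) (hlac : ∀ n, ρ (n + 1) ≤ θ * ρ n) (hζ : 0 < ζ)
    (hlacsum : ∀ N k, ∑ i ∈ Finset.Ico N k, (4 * ρ k / ρ i) ^ p ≤ ζ)
    (hζ' : 4 * C * b * ζ ≤ κ * a / (b * 10 ^ δ) * a ^ 2) (hg : ¬ Summable g)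
    {ε : ℝ} (hε : 0 < ε) :
    ∃ s₀ : ℝ, 0 < s₀ ∧ ∀ s, 0 < s → s ≤ s₀ → ∀ (x₀ : Ω) (N : ℕ),
      ∃ (ν : Measure Ω) (H : ENNReal) (A : Set Ω) (τ : ℝ), 0 < τ ∧ H ≠ ⊤ ∧ ν univ = 1 ∧
        MeasurableSet A ∧ ν Aᶜ = 0 ∧ ν ≤ H • m ∧ A ⊆ Metric.ball x₀ s ∧
        Metric.thickening τ A ⊆ ⋃ n ≥ N, E n ∧
        ∀ x r, 0 < r → ν (Metric.ball x r) ≤ ENNReal.ofReal (ε * s ^ (-δ) * f r) := by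
  have ha := hB.a_pos
  have hb := hB.b_pos
  have hC := h.C_pos
  have hκ := h.κ_pos
  set c₃ : ℝ := κ * a / (b * 10 ^ δ) with hc₃
  have hc₃0 : 0 < c₃ := by positivity
  set C₃ : ℝ := b * 3 ^ δ / a with hC₃
  have hC₃0 : 0 < C₃ := by positivity
  -- The total mass will be at least `(c₃ / 2) s^δ K = 2 C s^δ / ε`, so after normalisation the term
  -- `C * f r` costs half of `ε s^(-δ) f r`.
  set K : ℝ := 4 * C / (c₃ * ε) with hK
  have hK0 : 0 < K := by positivity
  obtain ⟨r₁, hr₁, hubiq⟩ := h.ubiq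
  -- The first entry makes the term in `r^δ` cost the other half, the second settles radii above
  -- `s`, and the third bounds the sum of `(t i / ρ i)^p` by `ζ`.
  obtain ⟨s₁, hs₁, hs₁f⟩ := exists_forall_rpow_le hfδ
    (ω := min (ε * c₃ / (8 * C₃)) (min ε (ζ / K))) (by positivity)
  refine ⟨min s₁ (min r₀ r₁), lt_min hs₁ (lt_min hB.r₀_pos hr₁), ?_⟩
  intro s hs hss x₀ N
  have hss₁ : s ≤ s₁ := hss.trans (min_le_left _ _)
  have hsr₀ : s ≤ r₀ := hss.trans ((min_le_right _ _).trans (min_le_left _ _))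
  have hsr₁ : s ≤ r₁ := hss.trans ((min_le_right _ _).trans (min_le_right _ _))
  have hfa : ∀ r, 0 < r → r ≤ s → r ^ δ ≤ ε * c₃ / (8 * C₃) * f r := fun r hr hrs =>
    (hs₁f r hr (hrs.trans hss₁)).trans
      (mul_le_mul_of_nonneg_right (min_le_left _ _) (hf r hr).le)
  have hfb : ∀ r, 0 < r → r ≤ s → r ^ δ ≤ ε * f r := fun r hr hrs =>
    (hs₁f r hr (hrs.trans hss₁)).trans
      (mul_le_mul_of_nonneg_right ((min_le_right _ _).trans (min_le_left _ _)) (hf r hr).le)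
  have hfc : ∀ r, 0 < r → r ≤ s → r ^ δ ≤ ζ / K * f r := fun r hr hrs =>
    (hs₁f r hr (hrs.trans hss₁)).trans
      (mul_le_mul_of_nonneg_right ((min_le_right _ _).trans (min_le_right _ _)) (hf r hr).le)
  have hsδ : 0 < s ^ δ := Real.rpow_pos_of_pos hs _
  obtain ⟨N₁, hN₁⟩ := eventually_atTop.1 ((eventually_ge_atTop N).and
    ((h.ρ_lim.eventually_le_const (show (0 : ℝ) < s / 4 by positivity)).and
      (hubiq x₀ (s / 2) (by positivity) (by linarith))))
  have hpack : ∀ k, ∃ S : Finset Ω, N₁ ≤ k → (∀ c ∈ S, c ∈ Z k ∧ dist c x₀ < 3 * s / 4) ∧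
      (S : Set Ω).Pairwise (fun x y => 4 * ρ k ≤ dist x y) ∧
      c₃ * s ^ δ ≤ S.card * ρ k ^ δ ∧ S.card * ρ k ^ δ ≤ b / a * s ^ δ := by
    intro k
    by_cases hk : N₁ ≤ k
    · obtain ⟨S, hS⟩ := h.exists_packing hB hs hsr₀ (hN₁ k hk).2.1 (hN₁ k hk).2.2
      exact ⟨S, fun _ => hS⟩
    -- Below `N₁` the packing is a dummy value; only levels from `N₁` on are used.
    · exact ⟨∅, fun hk' => absurd hk' hk⟩
  choose S hS using hpack
  obtain ⟨M, hNM, hMlow, hMup⟩ := exists_block h.g_pos hg hK0 N₁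
  have hw := sum_min_bounds h.g_pos hNM hMlow hMup
  set w : ℕ → ℝ := fun k => min (g k) K with hwdef
  have hw0 : ∀ k, 0 ≤ w k := fun k => le_min (h.g_pos k).le hK0.le
  set I := Finset.Ico N₁ (M + 1) with hI
  have hIN : ∀ k ∈ I, N₁ ≤ k := fun k hk => (Finset.mem_Ico.1 hk).1
  set G : ℕ → Finset Ω := goodCentres ρ T S N₁ with hG
  have hGS : ∀ k, G k ⊆ S k := goodCentres_subset ρ T S N₁
  have hρs : ∀ k, N₁ ≤ k → ρ k ≤ s / 4 := fun k hk => (hN₁ k hk).2.1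
  have hanti : ∀ i j, ρ (i + (j + 1)) ≤ ρ i / 8 := by
    intro i j
    induction j with
    | zero =>
      have := h.ρ_pos i
      have h2 := hlac i
      simp only [zero_add]
      nlinarith
    | succ j ih =>
      have := h.ρ_pos (i + (j + 1))
      have h2 := hlac (i + (j + 1))
      rw [← add_assoc]
      nlinarith
  have hgood : ∀ k ∈ I, c₃ / 2 * s ^ δ ≤ (G k).card * ρ k ^ δ := by
    intro k hk
    have hkI := Finset.mem_Ico.1 hk
    have hkN := hIN k hk
    refine h.le_card_goodCentres hB hs (ζ := ζ) (fun i hi _ c hc => ((hS i hi).1 c hc).1)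
      (hS k hkN).2.1 (hS k hkN).2.2.1 (fun i hi _ => (hS i hi).2.2.2)
      (by linarith [hρs k hkN]) ?_ ?_ (hlacsum N₁ k) hζ'
    · intro i hi
      obtain ⟨j, rfl⟩ := Nat.exists_eq_add_of_lt (Finset.mem_Ico.1 hi).2
      exact hanti i j
    · have hterm : ∀ i ∈ Finset.Ico N₁ k, (t i / ρ i) ^ p ≤ ζ / K * g i := by
        intro i hi
        have hti := h.t_pos i
        have hft := hf _ hti
        have h1 := hfc (t i) hti (by linarith [h.t_le i, hρs i (Finset.mem_Ico.1 hi).1])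
        refine le_of_mul_le_mul_right ((h.ratio_le i).trans ?_) hft
        calc g i * t i ^ δ ≤ g i * (ζ / K * f (t i)) := by
              have := h.g_pos i
              gcongr
          _ = _ := by ring
      calc ∑ i ∈ Finset.Ico N₁ k, (t i / ρ i) ^ p ≤ ∑ i ∈ Finset.Ico N₁ k, ζ / K * g i :=
            Finset.sum_le_sum hterm
        _ = ζ / K * ∑ i ∈ Finset.Ico N₁ k, g i := by rw [Finset.mul_sum]
        -- Only levels strictly below `k ≤ M` occur, so the possibly huge last term `g M` does not
        -- enter.
        _ ≤ ζ / K * ∑ i ∈ Finset.Ico N₁ M, g i := by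
            gcongr ζ / K * ?_
            exact Finset.sum_le_sum_of_subset_of_nonneg
              (Finset.Ico_subset_Ico_right (by omega)) fun i _ _ => (h.g_pos i).le
        _ ≤ ζ / K * K := by gcongr
        _ = ζ := by field_simp
  have hGZ : ∀ k ∈ I, ∀ c ∈ G k, c ∈ Z k ∧ dist c x₀ < 3 * s / 4 := fun k hk c hc =>
    (hS k (hIN k hk)).1 c (hGS k hc)
  set F : Set Ω → ℝ := fun B => ∑ k ∈ I, ∑ c ∈ G k, w k * pieceMass m δ ρ T k c B with hF
  have hFuniv : c₃ / 2 * s ^ δ * K ≤ F univ := by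
    calc c₃ / 2 * s ^ δ * K ≤ c₃ / 2 * s ^ δ * ∑ k ∈ I, w k := by
          gcongr
          exact hw.1
      _ = ∑ k ∈ I, w k * (c₃ / 2 * s ^ δ) := by rw [mul_comm, Finset.sum_mul]
      _ ≤ ∑ k ∈ I, w k * ((G k).card * ρ k ^ δ) := Finset.sum_le_sum fun k hk =>
          mul_le_mul_of_nonneg_left (hgood k hk) (hw0 k)
      _ = F univ := by
          refine Finset.sum_congr rfl fun k hk => ?_
          rw [Finset.sum_congr rfl fun c hc => by rw [h.pieceMass_univ (hGZ k hk c hc).1]]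
          rw [Finset.sum_const, nsmul_eq_mul]
          ring
  have hFpos : 0 < F univ := lt_of_lt_of_le (by positivity) hFuniv
  have hFball : ∀ x r, 0 < r → F (Metric.ball x r) ≤ C * f r + 2 * K * (C₃ * r ^ δ) := by
    intro x r hr
    refine (h.sum_sum_pieceMass_le hB (fun k hk c hc => ((hS k (hIN k hk)).1 c hc).1)
      (fun k hk => (hS k (hIN k hk)).2.1) (fun k hk => by linarith [hρs k (hIN k hk)]) hw0
      (fun k => min_le_left _ _) hf hr).trans ?_
    gcongr
    exact hw.2
  obtain ⟨H₀, hH₀, hH₀le⟩ := blockMeasure_le (m := m) (δ := δ) (ρ := ρ) (T := T) w I G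
  have hTopen : ∀ k ∈ I, ∀ c ∈ G k, IsOpen (T k c) := fun k hk c hc =>
    h.piece_open k c (hGZ k hk c hc).1
  -- The block is finite, so its smallest target radius serves as a common `τ`.
  obtain ⟨k₀, hk₀, hk₀min⟩ := Finset.exists_min_image I t
    ⟨N₁, Finset.mem_Ico.2 ⟨le_rfl, by omega⟩⟩
  have hν1 : ((ENNReal.ofReal (F univ))⁻¹ • blockMeasure m δ ρ T w I G) univ = 1 := by
    rw [Measure.smul_apply, h.blockMeasure_apply hw0 I G MeasurableSet.univ, smul_eq_mul]
    exact ENNReal.inv_mul_cancel (by simpa using hFpos) ENNReal.ofReal_ne_top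
  refine ⟨(ENNReal.ofReal (F univ))⁻¹ • blockMeasure m δ ρ T w I G,
    (ENNReal.ofReal (F univ))⁻¹ * H₀, ⋃ k ∈ I, ⋃ c ∈ G k, T k c, t k₀, h.t_pos _, ?_, hν1, ?_, ?_,
    ?_, ?_, ?_, ?_⟩
  · exact ENNReal.mul_ne_top (ENNReal.inv_ne_top.2 (by simpa using hFpos)) hH₀
  · exact Finset.measurableSet_biUnion _ fun k hk => Finset.measurableSet_biUnion _ fun c hc =>
      (hTopen k hk c hc).measurableSet
  · rw [Measure.smul_apply, blockMeasure_compl w I G fun k hk c hc =>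
      (hTopen k hk c hc).measurableSet, smul_zero]
  · rw [mul_smul]
    refine Measure.le_iff.2 fun B _ => ?_
    rw [Measure.smul_apply, Measure.smul_apply, smul_eq_mul, smul_eq_mul]
    gcongr
  · refine iUnion₂_subset fun k hk => iUnion₂_subset fun c hc => ?_
    refine (h.piece_subset k c (hGZ k hk c hc).1).trans (Metric.ball_subset_ball' ?_)
    linarith [(hGZ k hk c hc).2, hρs k (hIN k hk)]
  · intro z hz
    obtain ⟨y, hy, hzy⟩ := Metric.mem_thickening_iff.1 hz
    simp only [mem_iUnion, exists_prop] at hy ⊢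
    obtain ⟨k, hk, c, hc, hyT⟩ := hy
    refine ⟨k, (hN₁ k (hIN k hk)).1, h.piece_target k c (hGZ k hk c hc).1 ?_⟩
    exact Metric.mem_thickening_iff.2 ⟨y, hyT, hzy.trans_le (hk₀min k hk)⟩
  · intro x r hr
    rcases le_or_gt r s with hrs | hrs
    · rw [Measure.smul_apply, h.blockMeasure_apply hw0 I G measurableSet_ball, smul_eq_mul,
        mul_comm, ← div_eq_mul_inv, ← ENNReal.ofReal_div_of_pos hFpos]
      refine ENNReal.ofReal_le_ofReal ?_
      rw [div_le_iff₀ hFpos]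
      have hfr := hf r hr
      calc F (Metric.ball x r) ≤ C * f r + 2 * K * (C₃ * r ^ δ) := hFball x r hr
        _ ≤ C * f r + 2 * K * (C₃ * (ε * c₃ / (8 * C₃) * f r)) := by
            gcongr
            exact hfa r hr hrs
        _ = ε * s ^ (-δ) * f r * (c₃ / 2 * s ^ δ * K) := by
            rw [Real.rpow_neg hs.le, hK]
            field_simp
            ring
        _ ≤ ε * s ^ (-δ) * f r * F univ := by
            have : 0 < s ^ (-δ) := Real.rpow_pos_of_pos hs _
            gcongr
    · refine (measure_mono (subset_univ _)).trans (hν1.trans_le ?_)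
      rw [ENNReal.one_le_ofReal, Real.rpow_neg hs.le, mul_right_comm, ← div_eq_mul_inv,
        one_le_div hsδ]
      refine (hfb s hs le_rfl).trans ?_
      gcongr
      exact hf_mono hs hr hrs.le

end Local

/-! ### Nested construction by redistribution of mass, and the mass distribution principle. -/

section Global

variable {Ω : Type*} [MetricSpace Ω] [MeasurableSpace Ω] [OpensMeasurableSpace Ω] {m : Measure Ω}

/-- The projection of a compact metric space onto a finite `s`-dense subset is a simple function. -/
theorem exists_simpleFunc_dist_lt [CompactSpace Ω] [Nonempty Ω] {s : ℝ} (hs : 0 < s) :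
    ∃ π : SimpleFunc Ω Ω, ∀ x, dist (π x) x < s := by
  have hdense := TopologicalSpace.denseRange_denseSeq Ω
  set e := TopologicalSpace.denseSeq Ω
  obtain ⟨I, hI⟩ := isCompact_univ.elim_finite_subcover (fun k => Metric.ball (e k) s)
    (fun _ => Metric.isOpen_ball) fun x _ => by
      obtain ⟨k, hk⟩ := hdense.exists_dist_lt x hs
      exact mem_iUnion.2 ⟨k, hk⟩
  refine ⟨SimpleFunc.nearestPt e (I.sup id), fun x => ?_⟩
  obtain ⟨k, hk, hx⟩ := mem_iUnion₂.1 (hI (mem_univ x))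
  have h1 := SimpleFunc.edist_nearestPt_le e x (Finset.le_sup (f := id) hk)
  rw [edist_dist, edist_dist, id] at h1
  have h2 := (ENNReal.ofReal_le_ofReal_iff dist_nonneg).1 h1
  rw [Metric.mem_ball, dist_comm] at hx
  exact h2.trans_lt hx

/-- The measure obtained from `μ` by replacing it on each fibre of `π` by a multiple of a given
measure. -/
noncomputable def redistribute (μ : Measure Ω) (π : SimpleFunc Ω Ω) (ν : Ω → Measure Ω) :
    Measure Ω :=
  ∑ c ∈ π.range, μ (π ⁻¹' {c}) • ν c

theorem redistribute_univ (μ : Measure Ω) (π : SimpleFunc Ω Ω) {ν : Ω → Measure Ω}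
    (hν : ∀ c, ν c univ = 1) : redistribute μ π ν univ = μ univ := by
  unfold redistribute
  rw [Measure.finsetSum_apply]
  simp only [Measure.smul_apply, hν, smul_eq_mul, mul_one]
  exact π.sum_range_measure_preimage_singleton μ

theorem redistribute_le {μ : Measure Ω} (hμ : μ univ = 1) (π : SimpleFunc Ω Ω) {ν : Ω → Measure Ω}
    {H : Ω → ENNReal} (hH : ∀ c, H c ≠ ⊤) (hν : ∀ c, ν c ≤ H c • m) :
    ∃ H' : ENNReal, H' ≠ ⊤ ∧ redistribute μ π ν ≤ H' • m := by
  refine ⟨∑ c ∈ π.range, H c, by simp [ENNReal.sum_eq_top, hH], ?_⟩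
  unfold redistribute
  rw [Finset.sum_smul]
  refine Finset.sum_le_sum fun c _ => Measure.le_iff.2 fun B _ => ?_
  have h1 : μ (π ⁻¹' {c}) ≤ 1 := hμ ▸ measure_mono (subset_univ _)
  calc (μ (π ⁻¹' {c}) • ν c) B = μ (π ⁻¹' {c}) * ν c B := rfl
    _ ≤ 1 * ν c B := by gcongr
    _ ≤ (H c • m) B := by rw [one_mul]; exact hν c B

/-- A fibre contributes only if its replacement, within `s` of `c`, meets `B(x, r)`; the fibre
itself is also within `s` of `c`, hence inside `B(x, r + 2s)`. -/
theorem redistribute_ball_le (μ : Measure Ω) {π : SimpleFunc Ω Ω} {s : ℝ}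
    (hπ : ∀ x, dist (π x) x < s) {ν : Ω → Measure Ω} {A : Ω → Set Ω} (hνA : ∀ c, ν c (A c)ᶜ = 0)
    (hA : ∀ c, A c ⊆ Metric.ball c s) {x : Ω} {r : ℝ} {M : ENNReal}
    (hM : ∀ c, ν c (Metric.ball x r) ≤ M) :
    redistribute μ π ν (Metric.ball x r) ≤ M * μ (Metric.ball x (r + 2 * s)) := by
  unfold redistribute
  rw [Measure.finsetSum_apply]
  calc ∑ c ∈ π.range, (μ (π ⁻¹' {c}) • ν c) (Metric.ball x r)
      ≤ ∑ c ∈ π.range, M * (μ.restrict (Metric.ball x (r + 2 * s))) (π ⁻¹' {c}) := by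
        refine Finset.sum_le_sum fun c _ => ?_
        rw [Measure.smul_apply, smul_eq_mul]
        by_cases hmeet : (A c ∩ Metric.ball x r).Nonempty
        · obtain ⟨y, hyA, hyB⟩ := hmeet
          have hsub : π ⁻¹' {c} ⊆ Metric.ball x (r + 2 * s) := by
            intro z hz
            have hyc := hA c hyA
            have hzc := hπ z
            rw [mem_preimage, mem_singleton_iff] at hz
            rw [hz] at hzc
            rw [Metric.mem_ball] at hyc hyB ⊢
            have := dist_triangle4 z c y x
            rw [dist_comm z c, dist_comm c y] at this
            linarith
          rw [Measure.restrict_apply (π.measurableSet_fiber c), inter_eq_left.2 hsub, mul_comm]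
          gcongr
          exact hM c
        · have hsub : Metric.ball x r ⊆ (A c)ᶜ := fun y hy hyA => hmeet ⟨y, hyA, hy⟩
          rw [measure_mono_null hsub (hνA c), mul_zero]
          exact zero_le
    _ = M * μ (Metric.ball x (r + 2 * s)) := by
        rw [← Finset.mul_sum, π.sum_range_measure_preimage_singleton, Measure.restrict_apply_univ]

/-- Fibres missing `A₀` carry no mass. Dropping them keeps the new support close to the old one. -/
theorem redistribute_compl {μ : Measure Ω} {π : SimpleFunc Ω Ω} {ν : Ω → Measure Ω}
    {A : Ω → Set Ω} (hνA : ∀ c, ν c (A c)ᶜ = 0) {A₀ : Set Ω} (hμ : μ A₀ᶜ = 0) :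
    redistribute μ π ν
      (⋃ c ∈ {c | c ∈ π.range ∧ (π ⁻¹' {c} ∩ A₀).Nonempty}, A c)ᶜ = 0 := by
  unfold redistribute
  rw [Measure.finsetSum_apply]
  refine Finset.sum_eq_zero fun c hc => ?_
  rw [Measure.smul_apply, smul_eq_mul]
  by_cases hne : (π ⁻¹' {c} ∩ A₀).Nonempty
  · refine mul_eq_zero_of_right _ (measure_mono_null (compl_subset_compl.2 ?_) (hνA c))
    exact subset_biUnion_of_mem (u := A) (show c ∈ {c | c ∈ π.range ∧ _} from ⟨hc, hne⟩)
  · exact mul_eq_zero_of_left (measure_mono_null (fun z hz hzA => hne ⟨z, hz, hzA⟩) hμ) _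

/-- A stage of the construction of a large compact subset of the limsup set: a probability measure
`μ` of bounded density, concentrated on `A`, with a Frostman estimate at the scales above `σ` which
is stable under perturbations of size `σ`. -/
structure IsMassStage (m : Measure Ω) (f : ℝ → ℝ) (δ b η t : ℝ) (μ : Measure Ω) (A : Set Ω)
    (σ : ℝ) : Prop where
  prob : μ univ = 1
  meas : MeasurableSet A
  compl : μ Aᶜ = 0
  σ_pos : 0 < σ
  σ_le : σ ≤ t
  -- The factor `4` absorbs the enlargement `r + σ' + 2s ≤ 4r`, for `σ' ≤ s ≤ r`, at the next stage.
  density : ∃ H : ℝ, 0 < H ∧ μ ≤ ENNReal.ofReal H • m ∧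
    ∀ r, 0 < r → r ≤ σ → H * (b * (4 * r) ^ δ) ≤ f r / η
  frostman : ∀ x r, σ ≤ r → r ≤ t → μ (Metric.ball x (r + σ)) ≤ ENNReal.ofReal (f r / η)

theorem measure_ball_le_of_le_smul [IsProbabilityMeasure m] {δ a b r₀ : ℝ}
    (hB : BallBounds m δ a b r₀) {μ : Measure Ω} {H : ℝ} (hH : 0 < H)
    (hμ : μ ≤ ENNReal.ofReal H • m) (x : Ω) {r : ℝ} (hr : 0 < r) :
    μ (Metric.ball x r) ≤ ENNReal.ofReal (H * (b * r ^ δ)) := by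
  refine (hμ _).trans ?_
  rw [Measure.smul_apply, smul_eq_mul, ENNReal.ofReal_mul hH.le, ← ofReal_measureReal]
  gcongr
  exact hB.upper x r hr

theorem IsMassStage.ball_le [IsProbabilityMeasure m] {f : ℝ → ℝ} {δ a b r₀ η t : ℝ}
    {μ : Measure Ω} {A : Set Ω} {σ : ℝ} (h : IsMassStage m f δ b η t μ A σ)
    (hB : BallBounds m δ a b r₀) (x : Ω) {r : ℝ} (hr : 0 < r) (hrt : r ≤ t) :
    μ (Metric.ball x r) ≤ ENNReal.ofReal (f r / η) := by
  have hb := hB.b_pos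
  rcases le_total σ r with hσ | hσ
  · exact (measure_mono (Metric.ball_subset_ball (by linarith [h.σ_pos]))).trans
      (h.frostman x r hσ hrt)
  · obtain ⟨H, hH, hμ, hHf⟩ := h.density
    refine (measure_ball_le_of_le_smul hB hH hμ x hr).trans (ENNReal.ofReal_le_ofReal ?_)
    refine le_trans ?_ (hHf r hr hσ)
    have := hB.δ_pos
    gcongr
    linarith

/-- A measure of bounded density satisfies any Frostman bound in `f` at small enough scales, because
`r^δ = o(f r)`. -/
theorem exists_density_scale {f : ℝ → ℝ} {δ b η H : ℝ} (hb : 0 < b) (hη : 0 < η) (hH : 0 < H)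
    (hfδ : Tendsto (fun r : ℝ => r ^ (-δ) * f r) (𝓝[>] 0) atTop) :
    ∃ σ : ℝ, 0 < σ ∧ ∀ r, 0 < r → r ≤ σ → H * (b * (4 * r) ^ δ) ≤ f r / η := by
  obtain ⟨σ, hσ, hσf⟩ := exists_forall_rpow_le hfδ (ω := 1 / (H * b * 4 ^ δ * η)) (by positivity)
  refine ⟨σ, hσ, fun r hr hrσ => ?_⟩
  rw [Real.mul_rpow (by norm_num) hr.le]
  calc H * (b * (4 ^ δ * r ^ δ)) = H * b * 4 ^ δ * r ^ δ := by ring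
    _ ≤ H * b * 4 ^ δ * (1 / (H * b * 4 ^ δ * η) * f r) := by
        gcongr
        exact hσf r hr hrσ
    _ = f r / η := by field_simp

/-- The initial stage of the construction. -/
theorem exists_isMassStage [IsProbabilityMeasure m] {f : ℝ → ℝ} {δ a b r₀ η : ℝ}
    (hB : BallBounds m δ a b r₀) (hη : 0 < η)
    (hfδ : Tendsto (fun r : ℝ => r ^ (-δ) * f r) (𝓝[>] 0) atTop) :
    ∃ t : ℝ, 0 < t ∧ IsMassStage m f δ b η t m univ t := by
  have hb := hB.b_pos
  obtain ⟨t, ht, htf⟩ := exists_density_scale hb hη one_pos hfδ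
  refine ⟨t, ht, measure_univ, MeasurableSet.univ, by simp, ht, le_rfl,
    ⟨1, one_pos, by simp, htf⟩, ?_⟩
  intro x r hr hr'
  -- With `σ = t` the Frostman range is the single radius `t`.
  have hrt : r = t := le_antisymm hr' hr
  refine (measure_ball_le_of_le_smul hB one_pos (by simp) x (by linarith)).trans
    (ENNReal.ofReal_le_ofReal (le_trans ?_ (htf r (by linarith) hr')))
  have := hB.δ_pos
  have hr0 : 0 < r := by linarith
  gcongr
  linarith

variable [CompactSpace Ω] [IsProbabilityMeasure m]

/-- The inductive step of the construction. -/
theorem IsMassStage.exists_next {f : ℝ → ℝ} {δ a b r₀ η t : ℝ} {E : Set Ω}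
    (hB : BallBounds m δ a b r₀) (hη : 0 < η) (hf : ∀ r, 0 < r → 0 < f r)
    (hfδ : Tendsto (fun r : ℝ => r ^ (-δ) * f r) (𝓝[>] 0) atTop)
    (hfδ_anti : AntitoneOn (fun r : ℝ => r ^ (-δ) * f r) (Ioi 0))
    (hloc : ∀ ε : ℝ, 0 < ε → ∃ s₀ : ℝ, 0 < s₀ ∧ ∀ s, 0 < s → s ≤ s₀ → ∀ x₀ : Ω,
      ∃ (ν : Measure Ω) (H : ENNReal) (A : Set Ω) (τ : ℝ), 0 < τ ∧ H ≠ ⊤ ∧ ν univ = 1 ∧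
        MeasurableSet A ∧ ν Aᶜ = 0 ∧ ν ≤ H • m ∧ A ⊆ Metric.ball x₀ s ∧
        Metric.thickening τ A ⊆ E ∧
        ∀ x r, 0 < r → ν (Metric.ball x r) ≤ ENNReal.ofReal (ε * s ^ (-δ) * f r))
    {μ : Measure Ω} {A : Set Ω} {σ : ℝ} (h : IsMassStage m f δ b η t μ A σ) :
    ∃ (μ' : Measure Ω) (A' : Set Ω) (σ' : ℝ), IsMassStage m f δ b η t μ' A' σ' ∧
      Metric.thickening σ' A' ⊆ E ∧
      Metric.cthickening (σ' / 2) A' ⊆ Metric.cthickening (σ / 2) A := by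
  classical
  have hb := hB.b_pos
  have hδ := hB.δ_pos
  have hσ := h.σ_pos
  have : Nonempty Ω := by
    have : Nonempty (univ : Set Ω) := nonempty_of_measure_ne_zero (μ := m) (by simp)|>.to_subtype
    exact ⟨this.some.1⟩
  obtain ⟨H, hH, hμH, hHf⟩ := h.density
  -- For `r < s` the new mass is at most `ε s^(-δ) f (2r) * H b (4s)^δ`. The powers of `s` cancel
  -- and `f (2r) ≤ 2^δ f r`, so this `ε` gives exactly `f r / η`, whatever `s` is.
  obtain ⟨s₀, hs₀, hloc⟩ := hloc (1 / (H * b * 8 ^ δ * η)) (by positivity)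
  obtain ⟨s, hs, hss₀, hsσ⟩ : ∃ s, 0 < s ∧ s ≤ s₀ ∧ s ≤ σ / 8 :=
    ⟨min s₀ (σ / 8), by positivity, min_le_left _ _, min_le_right _ _⟩
  choose ν Hc Ac τ hτ hHc hν hAc hνA hνm hAs hAE hνf using hloc s hs hss₀
  obtain ⟨π, hπ⟩ := exists_simpleFunc_dist_lt (Ω := Ω) hs
  obtain ⟨H₁, hH₁, hμ'H₁⟩ := redistribute_le h.prob π hHc hνm
  set μ' := redistribute μ π ν with hμ'
  have hH₂ : μ' ≤ ENNReal.ofReal (H₁.toReal + 1) • m := by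
    refine hμ'H₁.trans (Measure.le_iff.2 fun B _ => ?_)
    rw [Measure.smul_apply, Measure.smul_apply, smul_eq_mul, smul_eq_mul]
    gcongr
    exact (ENNReal.le_ofReal_iff_toReal_le hH₁ (by positivity)).2 (by linarith)
  obtain ⟨σ₁, hσ₁, hσ₁f⟩ := exists_density_scale (H := H₁.toReal + 1) hb hη (by positivity) hfδ
  obtain ⟨c₀, -, hc₀⟩ := Finset.exists_min_image π.range τ
    ⟨π (Classical.arbitrary Ω), π.mem_range_self _⟩
  obtain ⟨σ', hσ', hσ'1, hσ's, hσ'τ⟩ : ∃ σ', 0 < σ' ∧ σ' ≤ σ₁ ∧ σ' ≤ s ∧ σ' ≤ τ c₀ :=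
    ⟨min σ₁ (min s (τ c₀)), by have := hτ c₀; positivity, min_le_left _ _,
      (min_le_right _ _).trans (min_le_left _ _), (min_le_right _ _).trans (min_le_right _ _)⟩
  set A' := ⋃ c ∈ {c | c ∈ π.range ∧ (π ⁻¹' {c} ∩ A).Nonempty}, Ac c with hA'
  have hA'A : A' ⊆ Metric.thickening (2 * s) A := by
    refine iUnion₂_subset fun c hc y hy => ?_
    obtain ⟨-, z, hz, hzA⟩ := hc
    refine Metric.mem_thickening_iff.2 ⟨z, hzA, ?_⟩
    have h1 := hAs c hy
    have h2 := hπ z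
    rw [mem_preimage, mem_singleton_iff] at hz
    rw [hz] at h2
    rw [Metric.mem_ball] at h1
    linarith [dist_triangle y c z]
  refine ⟨μ', A', σ', ⟨?_, ?_, ?_, hσ', by linarith [h.σ_le], ?_, ?_⟩, ?_, ?_⟩
  · rw [hμ', redistribute_univ μ π hν, h.prob]
  · refine Set.Finite.measurableSet_biUnion ?_ fun c _ => hAc c
    exact π.range.finite_toSet.subset fun c hc => hc.1
  · exact redistribute_compl hνA h.compl
  · exact ⟨H₁.toReal + 1, by positivity, hH₂, fun r hr hrσ => hσ₁f r hr (hrσ.trans hσ'1)⟩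
  · intro x r hr hrt
    have hr0 : 0 < r := hσ'.trans_le hr
    -- Below `s` the local measures give the bound, between `s` and `σ` the density of `μ`, and
    -- above `σ` its Frostman estimate, where `σ' + 2s ≤ σ` uses `s ≤ σ / 8`.
    rcases lt_or_ge r s with hrs | hrs
    · have hf2 : f (2 * r) ≤ 2 ^ δ * f r := by
        have h1 := hfδ_anti (mem_Ioi.2 hr0) (mem_Ioi.2 (by positivity : 0 < 2 * r))
          (by linarith)
        have hrδ : 0 < r ^ δ := by positivity
        simp only [Real.rpow_neg hr0.le, Real.rpow_neg (by positivity : 0 ≤ 2 * r)] at h1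
        rw [inv_mul_eq_div, inv_mul_eq_div, Real.mul_rpow (by norm_num) hr0.le,
          div_le_div_iff₀ (by positivity) hrδ] at h1
        refine le_of_mul_le_mul_right (h1.trans_eq ?_) hrδ
        ring
      calc μ' (Metric.ball x (r + σ')) ≤ μ' (Metric.ball x (2 * r)) :=
            measure_mono (Metric.ball_subset_ball (by linarith))
        _ ≤ ENNReal.ofReal (1 / (H * b * 8 ^ δ * η) * s ^ (-δ) * f (2 * r)) *
              μ (Metric.ball x (2 * r + 2 * s)) :=
            redistribute_ball_le μ hπ hνA hAs fun c => hνf c x (2 * r) (by positivity)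
        _ ≤ ENNReal.ofReal (1 / (H * b * 8 ^ δ * η) * s ^ (-δ) * (2 ^ δ * f r)) *
              ENNReal.ofReal (H * (b * (4 * s) ^ δ)) := by
            gcongr
            refine (measure_mono (Metric.ball_subset_ball (by linarith))).trans
              (measure_ball_le_of_le_smul hB hH hμH x (by positivity))
        _ = ENNReal.ofReal (f r / η) := by
            have hfr := hf r hr0
            rw [← ENNReal.ofReal_mul (by positivity)]
            congr 1
            have h8 : (8 : ℝ) ^ δ = 2 ^ δ * 4 ^ δ := by
              rw [← Real.mul_rpow (by norm_num) (by norm_num)]; norm_num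
            rw [h8, Real.rpow_neg hs.le, Real.mul_rpow (by norm_num) hs.le]
            field_simp
    · have hM : ∀ r' (c : Ω), ν c (Metric.ball x r') ≤ 1 := fun r' c =>
        (measure_mono (subset_univ _)).trans (hν c).le
      have hone := redistribute_ball_le μ hπ hνA hAs (hM (r + σ'))
      rw [one_mul] at hone
      refine hone.trans ?_
      rcases le_total r σ with hrσ | hrσ
      · refine (measure_ball_le_of_le_smul hB hH hμH x (by positivity)).trans
          (ENNReal.ofReal_le_ofReal (le_trans ?_ (hHf r hr0 hrσ)))
        gcongr
        linarith
      · exact (measure_mono (Metric.ball_subset_ball (by linarith))).trans (h.frostman x r hrσ hrt)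
  · intro z hz
    obtain ⟨y, hy, hzy⟩ := Metric.mem_thickening_iff.1 hz
    obtain ⟨c, hc, hyc⟩ := mem_iUnion₂.1 hy
    exact hAE c (Metric.mem_thickening_iff.2 ⟨y, hyc, hzy.trans_le (hσ'τ.trans (hc₀ c hc.1))⟩)
  · calc Metric.cthickening (σ' / 2) A'
        ⊆ Metric.cthickening (σ' / 2) (Metric.thickening (2 * s) A) :=
          Metric.cthickening_subset_of_subset _ hA'A
      _ ⊆ Metric.cthickening (σ' / 2 + 2 * s) A :=
          Metric.cthickening_thickening_subset (by positivity) _ _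
      _ ⊆ Metric.cthickening (σ / 2) A := Metric.cthickening_mono (by linarith) _

/-- If every small ball carries suitable measures living on the sets `E n`, then the limsup of these
sets has infinite Hausdorff `f`-measure. -/
theorem hausdorffMeasureFun_limsup_eq_top {f : ℝ → ℝ} {δ a b r₀ : ℝ} {E : ℕ → Set Ω}
    (hB : BallBounds m δ a b r₀) (hf : ∀ r, 0 < r → 0 < f r)
    (hfδ : Tendsto (fun r : ℝ => r ^ (-δ) * f r) (𝓝[>] 0) atTop)
    (hfδ_anti : AntitoneOn (fun r : ℝ => r ^ (-δ) * f r) (Ioi 0))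
    (hloc : ∀ ε : ℝ, 0 < ε → ∃ s₀ : ℝ, 0 < s₀ ∧ ∀ s, 0 < s → s ≤ s₀ → ∀ (x₀ : Ω) (N : ℕ),
      ∃ (ν : Measure Ω) (H : ENNReal) (A : Set Ω) (τ : ℝ), 0 < τ ∧ H ≠ ⊤ ∧ ν univ = 1 ∧
        MeasurableSet A ∧ ν Aᶜ = 0 ∧ ν ≤ H • m ∧ A ⊆ Metric.ball x₀ s ∧
        Metric.thickening τ A ⊆ ⋃ n ≥ N, E n ∧
        ∀ x r, 0 < r → ν (Metric.ball x r) ≤ ENNReal.ofReal (ε * s ^ (-δ) * f r)) :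
    hausdorffMeasureFun f {x | ∃ᶠ n in atTop, x ∈ E n} = ⊤ := by
  refine ENNReal.eq_top_of_forall_nnreal_le fun η₀ => ?_
  obtain ⟨η, hη, hη₀⟩ : ∃ η : ℝ, 0 < η ∧ (η₀ : ENNReal) ≤ ENNReal.ofReal η := by
    refine ⟨η₀ + 1, by positivity, ?_⟩
    rw [← ENNReal.ofReal_coe_nnreal]
    exact ENNReal.ofReal_le_ofReal (by linarith)
  refine hη₀.trans ?_
  obtain ⟨t, ht, hstage⟩ := exists_isMassStage hB hη hfδ
  refine le_trans ?_ (le_iSup₂ (f := fun (t : ℝ) (_ : 0 < t) =>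
    hausdorffPre f t {x | ∃ᶠ n in atTop, x ∈ E n}) t ht)
  have hnext : ∀ (N : ℕ) (q : {q : Measure Ω × Set Ω × ℝ //
      IsMassStage m f δ b η t q.1 q.2.1 q.2.2}), ∃ q' : {q : Measure Ω × Set Ω × ℝ //
      IsMassStage m f δ b η t q.1 q.2.1 q.2.2},
      Metric.thickening q'.1.2.2 q'.1.2.1 ⊆ ⋃ n ≥ N, E n ∧
      Metric.cthickening (q'.1.2.2 / 2) q'.1.2.1 ⊆
        Metric.cthickening (q.1.2.2 / 2) q.1.2.1 := by
    rintro N ⟨⟨μ, A, σ⟩, hq⟩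
    obtain ⟨μ', A', σ', h', h1, h2⟩ := hq.exists_next hB hη hf hfδ hfδ_anti (fun ε hε => by
      obtain ⟨s₀, hs₀, h⟩ := hloc ε hε
      exact ⟨s₀, hs₀, fun s hs hs' x₀ => h s hs hs' x₀ N⟩)
    exact ⟨⟨⟨μ', A', σ'⟩, h'⟩, h1, h2⟩
  choose next hnextE hnextF using hnext
  let q : ℕ → {q : Measure Ω × Set Ω × ℝ // IsMassStage m f δ b η t q.1 q.2.1 q.2.2} :=
    fun n => Nat.rec ⟨⟨m, univ, t⟩, hstage⟩ next n
  have hq : ∀ n, q (n + 1) = next n (q n) := fun n => rfl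
  set F : ℕ → Set Ω := fun n => Metric.cthickening ((q n).1.2.2 / 2) (q n).1.2.1 with hF
  have hFanti : Antitone F := antitone_nat_of_succ_le fun n => by
    simp only [hF, hq]
    exact hnextF n (q n)
  have hFE : (⋂ n, F n) ⊆ {x | ∃ᶠ n in atTop, x ∈ E n} := by
    intro x hx
    refine frequently_atTop.2 fun N => ?_
    -- Stage `N + 1` is the one built with targets of index at least `N`.
    have h1 := mem_iInter.1 hx (N + 1)
    have h2 : x ∈ Metric.thickening (q (N + 1)).1.2.2 (q (N + 1)).1.2.1 :=
      Metric.cthickening_subset_thickening' (q (N + 1)).2.σ_pos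
        (half_lt_self (q (N + 1)).2.σ_pos) _ h1
    rw [hq] at h2
    simpa using hnextE N (q N) h2
  unfold hausdorffPre
  refine le_iInf₂ fun 𝒞 h𝒞 => le_iInf₂ fun hrad hcov => ?_
  -- The open cover of the intersection contains some `F j`, so testing it against the measure of
  -- stage `j` suffices.
  obtain ⟨j, hj⟩ := exists_subset_nhds_of_compactSpace (V := F)
    (U := ⋃ p ∈ 𝒞, Metric.ball p.1 p.2) hFanti.directed_ge (fun n => Metric.isClosed_cthickening)
    fun x hx => (isOpen_biUnion fun p _ => Metric.isOpen_ball).mem_nhds (hcov (hFE hx))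
  have hst := (q j).2
  set μ := (q j).1.1
  have hAcov : (q j).1.2.1 ⊆ ⋃ p ∈ 𝒞, Metric.ball p.1 p.2 :=
    (Metric.self_subset_cthickening _).trans hj
  have h1 : (1 : ENNReal) ≤ ∑' p : 𝒞, ENNReal.ofReal (f (p : Ω × ℝ).2) * ENNReal.ofReal η⁻¹ := by
    calc (1 : ENNReal) = μ univ := hst.prob.symm
      _ ≤ μ (q j).1.2.1 + μ (q j).1.2.1ᶜ := by
          rw [← union_compl_self (q j).1.2.1]
          exact measure_union_le _ _
      _ = μ (q j).1.2.1 := by rw [hst.compl, add_zero]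
      _ ≤ μ (⋃ p ∈ 𝒞, Metric.ball p.1 p.2) := measure_mono hAcov
      _ ≤ ∑' p : 𝒞, μ (Metric.ball (p : Ω × ℝ).1 (p : Ω × ℝ).2) := measure_biUnion_le _ h𝒞 _
      _ ≤ _ := by
          refine ENNReal.tsum_le_tsum fun p => ?_
          have hp := hrad p p.2
          rw [← ENNReal.ofReal_mul (hf _ hp.1).le, ← div_eq_mul_inv]
          exact hst.ball_le hB _ hp.1 hp.2
  rw [ENNReal.tsum_mul_right, ENNReal.ofReal_inv_of_pos hη, ← div_eq_mul_inv,
    ENNReal.le_div_iff_mul_le (Or.inl (by simpa using hη)) (Or.inl ENNReal.ofReal_ne_top),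
    one_mul] at h1
  exact h1

/-- The limsup set of a level system with lacunary divergent subsequences has infinite Hausdorff
`f`-measure. -/
theorem LevelSystem.hausdorffMeasureFun_eq_top {f : ℝ → ℝ} {δ p κ C a b r₀ : ℝ} {ρ t g : ℕ → ℝ}
    {Z : ℕ → Set Ω} {T : ℕ → Ω → Set Ω} {E : ℕ → Set Ω}
    (h : LevelSystem m f δ p κ C ρ t g Z T E) (hB : BallBounds m δ a b r₀)
    (hf : ∀ r, 0 < r → 0 < f r) (hf_mono : MonotoneOn f (Ioi 0))
    (hfδ : Tendsto (fun r : ℝ => r ^ (-δ) * f r) (𝓝[>] 0) atTop)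
    (hfδ_anti : AntitoneOn (fun r : ℝ => r ^ (-δ) * f r) (Ioi 0))
    (hsub : ∀ θ : ℝ, 0 < θ → ∃ φ : ℕ → ℕ, StrictMono φ ∧
      (∀ n, ρ (φ (n + 1)) ≤ θ * ρ (φ n)) ∧ ¬ Summable (g ∘ φ)) :
    hausdorffMeasureFun f {x | ∃ᶠ n in atTop, x ∈ E n} = ⊤ := by
  have ha := hB.a_pos
  have hb := hB.b_pos
  have hC := h.C_pos
  have hκ := h.κ_pos
  -- This `ζ` gives equality in the smallness condition under which at most half of the centres are
  -- discarded.
  obtain ⟨θ, hθ, hθ8, hlac⟩ := exists_lacunary_sum_le (p := p)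
    (ζ := κ * a / (b * 10 ^ δ) * a ^ 2 / (4 * C * b)) h.p_pos (by positivity)
  obtain ⟨φ, hφ, hφρ, hφg⟩ := hsub θ hθ
  have h' := h.comp hφ
  refine hausdorffMeasureFun_limsup_eq_top hB hf hfδ hfδ_anti fun ε hε => ?_
  obtain ⟨s₀, hs₀, hloc⟩ := h'.exists_local_measure hB hf hf_mono hfδ hθ8 hφρ (by positivity)
    (hlac (ρ ∘ φ) h'.ρ_pos hφρ) (le_of_eq (by field_simp)) hφg hε
  refine ⟨s₀, hs₀, fun s hs hs' x₀ N => ?_⟩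
  obtain ⟨ν, H, A, τ, h1, h2, h3, h4, h5, h6, h7, h8, h9⟩ := hloc s hs hs' x₀ N
  refine ⟨ν, H, A, τ, h1, h2, h3, h4, h5, h6, h7, h8.trans ?_, h9⟩
  refine iUnion₂_subset fun n hn => ?_
  exact subset_biUnion_of_mem (u := E) (show φ n ≥ N from le_trans hn (hφ.le_apply))

end Global

/-! ### Lacunary subsequences with divergent sum. -/

/-- `P + 1` regular steps shrink `ρ` by at least the factor `θ`; of the finitely many residue
classes modulo `P + 1`, one must carry the divergence. -/
theorem exists_lacunary_of_regular {ρ g : ℕ → ℝ} (hρ : ∀ n, 0 < ρ n) (hg : ∀ n, 0 < g n)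
    {c : ℝ} (hc : 0 < c) (hc1 : c < 1) (hreg : ∀ᶠ n in atTop, ρ (n + 1) ≤ c * ρ n)
    (hsum : ¬ Summable g) {θ : ℝ} (hθ : 0 < θ) :
    ∃ φ : ℕ → ℕ, StrictMono φ ∧ (∀ n, ρ (φ (n + 1)) ≤ θ * ρ (φ n)) ∧ ¬ Summable (g ∘ φ) := by
  obtain ⟨n₁, hn₁⟩ := eventually_atTop.1 hreg
  obtain ⟨P, hP⟩ := exists_pow_lt_of_lt_one hθ hc1
  have hiter : ∀ j n, n₁ ≤ n → ρ (n + j) ≤ c ^ j * ρ n := by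
    intro j n hn
    induction j with
    | zero => simp
    | succ j ih =>
      calc ρ (n + j + 1) ≤ c * ρ (n + j) := hn₁ _ (by omega)
        _ ≤ c * (c ^ j * ρ n) := by gcongr
        _ = c ^ (j + 1) * ρ n := by ring
  have hres : ∃ i : Fin (P + 1), ¬ Summable fun k => g (k * (P + 1) + i + n₁) := by
    by_contra! hall
    refine hsum ((summable_nat_add_iff n₁).1 ?_)
    rw [← (Nat.divModEquiv (P + 1)).symm.summable_iff, ← (Equiv.prodComm _ _).summable_iff]
    refine (summable_prod_of_nonneg fun _ => (hg _).le).2 ⟨fun i => ?_, Summable.of_finite⟩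
    simpa [Nat.divModEquiv, Function.comp_def] using hall i
  obtain ⟨i, hi⟩ := hres
  refine ⟨fun k => k * (P + 1) + i + n₁, strictMono_nat_of_lt_succ fun k => ?_, fun k => ?_, hi⟩
  · rw [add_mul]
    omega
  · have h1 := hiter (P + 1) (k * (P + 1) + i + n₁) (by omega)
    rw [show k * (P + 1) + i + n₁ + (P + 1) = (k + 1) * (P + 1) + i + n₁ by ring] at h1
    refine h1.trans (mul_le_mul_of_nonneg_right ?_ (hρ _).le)
    calc c ^ (P + 1) ≤ c ^ P := pow_le_pow_of_le_one hc.le hc1.le (by omega)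
      _ ≤ θ := hP.le

/-- Indices with `g ≥ ε` can be chosen as sparsely as desired, and along them `g` does not tend to
`0`. -/
theorem exists_lacunary_of_frequently {ρ g : ℕ → ℝ} (hρ : ∀ n, 0 < ρ n)
    (hρ0 : Tendsto ρ atTop (𝓝 0)) {ε : ℝ} (hε : 0 < ε) (hfreq : ∃ᶠ n in atTop, ε ≤ g n)
    {θ : ℝ} (hθ : 0 < θ) :
    ∃ φ : ℕ → ℕ, StrictMono φ ∧ (∀ n, ρ (φ (n + 1)) ≤ θ * ρ (φ n)) ∧ ¬ Summable (g ∘ φ) := by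
  have hstep : ∀ n, ∃ n', n < n' ∧ ρ n' ≤ θ * ρ n ∧ ε ≤ g n' := by
    intro n
    have h1 := hρ0.eventually_le_const (mul_pos hθ (hρ n))
    obtain ⟨n', h2, h3, h4⟩ := (hfreq.and_eventually (h1.and (eventually_gt_atTop n))).exists
    exact ⟨n', h4, h3, h2⟩
  choose next h1 h2 h3 using hstep
  -- The exponent `k + 1` skips the index `0`, where `g ≥ ε` need not hold.
  refine ⟨fun k => next^[k + 1] 0, strictMono_nat_of_lt_succ fun k => ?_, fun k => ?_, fun hs => ?_⟩
  · rw [Function.iterate_succ_apply' next (k + 1)]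
    exact h1 _
  · simp only [Function.iterate_succ_apply' next (k + 1)]
    exact h2 _
  · obtain ⟨k, hk⟩ := (hs.tendsto_atTop_zero.eventually_lt_const hε).exists
    simp only [Function.comp_apply, Function.iterate_succ_apply' next k] at hk
    linarith [h3 (next^[k] 0)]

/-! ### From the intersection conditions to a level system. -/

/-- The intersection conditions, in terms of real-valued measures and powers. -/
structure IntersectionBounds {Ω J : Type*} [MetricSpace Ω] [MeasurableSpace Ω] (m : Measure Ω)
    (R : J → Set Ω) (δ γ c₁ c₂ ρ : ℝ) (I : Set J) : Prop where
  lower : ∀ α ∈ I, ∀ c ∈ R α, ∀ t, 0 < t → t ≤ ρ →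
    c₁ * t ^ δ * (ρ / t) ^ γ ≤ m.real (Metric.ball c (ρ / 2) ∩ Metric.thickening t (R α))
  upper : ∀ α ∈ I, ∀ c ∈ R α, ∀ t, 0 < t → t ≤ ρ → ∀ y ∈ ⋃ α' : J, R α', ∀ s, 0 < s → s ≤ 3 * ρ →
    m.real (Metric.ball y s ∩ Metric.ball c (3 * ρ) ∩ Metric.thickening (3 * t) (R α)) ≤
      c₂ * t ^ δ * (s / t) ^ γ

theorem IntersectionConditions.exists_bounds {Ω J : Type*} [MetricSpace Ω] [MeasurableSpace Ω]
    {m : Measure Ω} [IsProbabilityMeasure m] {R : J → Set Ω} {β : J → ℝ} {ρ : ℝ → ℝ} {u : ℕ → ℝ}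
    {γ δ a b r₀ : ℝ} (h : IntersectionConditions m R β ρ u γ) (hB : BallBounds m δ a b r₀)
    (hρ : Tendsto (fun n => ρ (u n)) atTop (𝓝 0)) :
    ∃ c₁ c₂ : ℝ, 0 < c₁ ∧ 0 < c₂ ∧ ∀ᶠ n in atTop,
      IntersectionBounds m R δ γ c₁ c₂ (ρ (u n)) {α | β α ≤ u n} := by
  obtain ⟨-, -, c₁, c₂, hc₁, hc₂, h⟩ := h
  have ha := hB.a_pos
  have hb := hB.b_pos
  refine ⟨c₁ * a, c₂ * b, by positivity, by positivity, ?_⟩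
  filter_upwards [h, hρ.eventually_le_const hB.r₀_pos] with n hn hρn
  refine ⟨fun α hα c hc t ht ht' => ?_, fun α hα c hc t ht ht' y hy s hs hs' => ?_⟩
  · have h1 := (hn α hα c hc t ht ht').1
    have hrt : 0 < (ρ (u n) / t) ^ γ := Real.rpow_pos_of_pos (div_pos (ht.trans_le ht') ht) _
    rw [← ofReal_measureReal (μ := m) (s := Metric.ball c t), ← ENNReal.ofReal_mul hc₁.le,
      ← ENNReal.ofReal_mul (by positivity),
      ENNReal.ofReal_le_iff_le_toReal (measure_ne_top _ _)] at h1
    refine le_trans ?_ h1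
    rw [mul_assoc c₁]
    gcongr
    exact hB.lower c t ht (ht'.trans hρn)
  · have h1 := (hn α hα c hc t ht ht').2 y hy s hs hs'
    have hrt : 0 < (s / t) ^ γ := Real.rpow_pos_of_pos (div_pos hs ht) _
    rw [← ofReal_measureReal (μ := m) (s := Metric.ball c t), ← ENNReal.ofReal_mul hc₂.le,
      ← ENNReal.ofReal_mul (by positivity)] at h1
    refine (ENNReal.toReal_le_of_le_ofReal (by positivity) h1).trans ?_
    rw [mul_assoc c₂ b]
    gcongr
    exact hB.upper c t ht

namespace IntersectionBounds

variable {Ω J : Type*} [MetricSpace Ω] [MeasurableSpace Ω] {m : Measure Ω}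
  [IsProbabilityMeasure m] {R : J → Set Ω} {δ γ c₁ c₂ ρ : ℝ} {I : Set J} {f : ℝ → ℝ}

theorem measureReal_pos (h : IntersectionBounds m R δ γ c₁ c₂ ρ I) (hc₁ : 0 < c₁) {α : J}
    (hα : α ∈ I) {c : Ω} (hc : c ∈ R α) {t : ℝ} (ht : 0 < t) (ht' : t ≤ ρ) :
    0 < m.real (Metric.ball c (ρ / 2) ∩ Metric.thickening t (R α)) := by
  have hρ : 0 < ρ := ht.trans_le ht'
  exact lt_of_lt_of_le (by positivity) (h.lower α hα c hc t ht ht')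

/-- The weight is `f t * t^(-γ) * ρ^γ`, and the piece has measure at least `c₁ t^(δ-γ) ρ^γ`. For `r
≤ t` the ball bound `b r^δ` suffices since `r^(-δ) f r` decreases; for `r ≥ t` the upper
intersection condition gives a multiple of `t^(δ-γ) r^γ`, and `r^(-γ) f r` increases. -/
theorem measureReal_ball_inter_le (h : IntersectionBounds m R δ γ c₁ c₂ ρ I) (hc₁ : 0 < c₁)
    (hc₂ : 0 < c₂) {a b r₀ : ℝ} (hB : BallBounds m δ a b r₀) (hf : ∀ r, 0 < r → 0 < f r)
    (hfδ_anti : AntitoneOn (fun r : ℝ => r ^ (-δ) * f r) (Ioi 0))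
    (hfγ_mono : MonotoneOn (fun r : ℝ => r ^ (-γ) * f r) (Ioi 0)) {α : J}
    (hα : α ∈ I) {c : Ω} (hc : c ∈ R α) {t : ℝ} (ht : 0 < t) (ht' : t ≤ ρ) (x : Ω) {r : ℝ}
    (hr : 0 < r) (hr' : r ≤ ρ) :
    m.real (Metric.ball x r ∩ (Metric.ball c (ρ / 2) ∩ Metric.thickening t (R α))) *
        (f t * t ^ (-γ) * ρ ^ (γ - δ) * ρ ^ δ) ≤
      (b / c₁ + c₂ * 3 ^ γ / c₁) * f r *
        m.real (Metric.ball c (ρ / 2) ∩ Metric.thickening t (R α)) := by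
  have hρ : 0 < ρ := ht.trans_le ht'
  have hb := hB.b_pos
  have hft := hf t ht
  have hfr := hf r hr
  have hlow := h.lower α hα c hc t ht ht'
  rw [Real.div_rpow hρ.le ht.le] at hlow
  have hg : f t * t ^ (-γ) * ρ ^ (γ - δ) * ρ ^ δ = f t / t ^ γ * ρ ^ γ := by
    rw [Real.rpow_neg ht.le, mul_assoc _ (ρ ^ (γ - δ)), ← Real.rpow_add hρ]
    simp [div_eq_mul_inv]
  rw [hg]
  have htδ : 0 < t ^ δ := by positivity
  have htγ : 0 < t ^ γ := by positivity
  have hrδ : 0 < r ^ δ := by positivity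
  have hrγ : 0 < r ^ γ := by positivity
  have hργ : 0 < ρ ^ γ := by positivity
  have h3γ : (0 : ℝ) < 3 ^ γ := by positivity
  set X := m.real (Metric.ball x r ∩ (Metric.ball c (ρ / 2) ∩ Metric.thickening t (R α)))
  set Y := m.real (Metric.ball c (ρ / 2) ∩ Metric.thickening t (R α))
  have hX0 : 0 ≤ X := measureReal_nonneg
  have hY0 : 0 ≤ Y := measureReal_nonneg
  rcases le_total r t with hrt | hrt
  · have hX : X ≤ b * r ^ δ := (measureReal_mono inter_subset_left).trans (hB.upper x r hr)
    have h1 := hfδ_anti (mem_Ioi.2 hr) (mem_Ioi.2 ht) hrt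
    simp only [Real.rpow_neg hr.le, Real.rpow_neg ht.le] at h1
    rw [inv_mul_eq_div, inv_mul_eq_div, div_le_iff₀ htδ] at h1
    calc X * (f t / t ^ γ * ρ ^ γ) ≤ (b * r ^ δ) * (f r / r ^ δ * t ^ δ / t ^ γ * ρ ^ γ) := by
          gcongr
      _ = b / c₁ * f r * (c₁ * t ^ δ * (ρ ^ γ / t ^ γ)) := by field_simp
      _ ≤ b / c₁ * f r * Y := by gcongr
      _ ≤ _ := by
          gcongr
          exact le_add_of_nonneg_right (by positivity)
  · have hX : X ≤ c₂ * t ^ δ * (3 ^ γ * r ^ γ / t ^ γ) := by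
      rw [← Real.mul_rpow (by norm_num) hr.le, ← Real.div_rpow (by positivity) ht.le]
      rcases eq_empty_or_nonempty
        (Metric.ball x r ∩ (Metric.ball c (ρ / 2) ∩ Metric.thickening t (R α)))
        with he | ⟨z, hz, -, hzR⟩
      · have : X = 0 := by simp only [X, he, measureReal_empty]
        rw [this]
        positivity
      -- The upper condition requires a ball centred on a resonant set: a point `y` of `R α` within
      -- `t ≤ r` of the intersection gives `B(x, r) ⊆ B(y, 3r)`.
      · obtain ⟨y, hy, hzy⟩ := Metric.mem_thickening_iff.1 hzR
        refine le_trans (measureReal_mono ?_) (h.upper α hα c hc t ht ht' y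
          (mem_iUnion.2 ⟨α, hy⟩) (3 * r) (by positivity) (by linarith))
        rintro v ⟨hv, hvc, hvR⟩
        rw [Metric.mem_ball] at hv hvc hz
        refine ⟨⟨?_, ?_⟩, Metric.thickening_mono (by linarith) _ hvR⟩
        · rw [Metric.mem_ball]
          have := dist_triangle4 v x z y
          rw [dist_comm x z] at this
          linarith
        · rw [Metric.mem_ball]
          linarith
    have h1 := hfγ_mono (mem_Ioi.2 ht) (mem_Ioi.2 hr) hrt
    simp only [Real.rpow_neg hr.le, Real.rpow_neg ht.le] at h1
    rw [inv_mul_eq_div, inv_mul_eq_div] at h1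
    calc X * (f t / t ^ γ * ρ ^ γ)
        ≤ (c₂ * t ^ δ * (3 ^ γ * r ^ γ / t ^ γ)) * (f r / r ^ γ * ρ ^ γ) := by
          gcongr
      _ = c₂ * 3 ^ γ / c₁ * f r * (c₁ * t ^ δ * (ρ ^ γ / t ^ γ)) := by field_simp
      _ ≤ c₂ * 3 ^ γ / c₁ * f r * Y := by gcongr
      _ ≤ _ := by
          gcongr
          exact le_add_of_nonneg_left (by positivity)

/-- The upper condition is applied with `t + w` in place of `t`; the bounds `t, w ≤ ρ / 2` make this
admissible. -/
theorem measureReal_thickening_le (h : IntersectionBounds m R δ γ c₁ c₂ ρ I) (hc₂ : 0 < c₂)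
    (hγδ : γ < δ) {α : J} (hα : α ∈ I) {c : Ω} (hc : c ∈ R α) {t : ℝ} (ht : 0 < t)
    (ht' : 2 * t ≤ ρ) {w : ℝ} (hw : 0 < w) (hw' : w ≤ ρ / 2) :
    m.real (Metric.thickening w (Metric.ball c (ρ / 2) ∩ Metric.thickening t (R α))) ≤
      c₂ * 3 ^ γ * 2 ^ (δ - γ) * ρ ^ δ * ((t / ρ) ^ (δ - γ) + (w / ρ) ^ (δ - γ)) := by
  have hρ : 0 < ρ := by linarith
  have hp : 0 < δ - γ := by linarith
  have hsub : Metric.thickening w (Metric.ball c (ρ / 2) ∩ Metric.thickening t (R α)) ⊆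
      Metric.ball c (3 * ρ) ∩ Metric.ball c (3 * ρ) ∩
        Metric.thickening (3 * (t + w)) (R α) := by
    intro z hz
    obtain ⟨y, ⟨hyc, hyR⟩, hzy⟩ := Metric.mem_thickening_iff.1 hz
    obtain ⟨v, hv, hyv⟩ := Metric.mem_thickening_iff.1 hyR
    rw [Metric.mem_ball] at hyc
    have hzc : z ∈ Metric.ball c (3 * ρ) := by
      rw [Metric.mem_ball]
      linarith [dist_triangle z y c]
    exact ⟨⟨hzc, hzc⟩, Metric.mem_thickening_iff.2 ⟨v, hv, by linarith [dist_triangle z y v]⟩⟩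
  have h1 := (measureReal_mono hsub).trans (h.upper α hα c hc (t + w) (by positivity)
    (by linarith) c (mem_iUnion.2 ⟨α, hc⟩) (3 * ρ) (by positivity) le_rfl)
  have hsum : ((t + w) / ρ) ^ (δ - γ) ≤
      2 ^ (δ - γ) * ((t / ρ) ^ (δ - γ) + (w / ρ) ^ (δ - γ)) := by
    have hmax : (t + w) / ρ ≤ 2 * max (t / ρ) (w / ρ) := by
      rw [add_div]
      linarith [le_max_left (t / ρ) (w / ρ), le_max_right (t / ρ) (w / ρ)]
    calc ((t + w) / ρ) ^ (δ - γ) ≤ (2 * max (t / ρ) (w / ρ)) ^ (δ - γ) := by gcongr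
      _ = 2 ^ (δ - γ) * (max (t / ρ) (w / ρ)) ^ (δ - γ) :=
          Real.mul_rpow (by norm_num) (by positivity)
      _ ≤ _ := by
          gcongr
          have ht0 : 0 < (t / ρ) ^ (δ - γ) := by positivity
          have hw0 : 0 < (w / ρ) ^ (δ - γ) := by positivity
          rcases max_cases (t / ρ) (w / ρ) with ⟨hm, -⟩ | ⟨hm, -⟩ <;> rw [hm] <;> linarith
  refine h1.trans ?_
  have heq : c₂ * (t + w) ^ δ * (3 * ρ / (t + w)) ^ γ =
      c₂ * 3 ^ γ * ρ ^ δ * ((t + w) / ρ) ^ (δ - γ) := by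
    have htw : 0 < t + w := by positivity
    rw [Real.div_rpow (by positivity) htw.le, Real.mul_rpow (by norm_num) hρ.le,
      Real.div_rpow htw.le hρ.le, Real.rpow_sub htw, Real.rpow_sub hρ]
    field_simp
  rw [heq]
  calc c₂ * 3 ^ γ * ρ ^ δ * ((t + w) / ρ) ^ (δ - γ)
      ≤ c₂ * 3 ^ γ * ρ ^ δ * (2 ^ (δ - γ) * ((t / ρ) ^ (δ - γ) + (w / ρ) ^ (δ - γ))) := by gcongr
    _ = _ := by ring

end IntersectionBounds

/-- Every point of a resonant set in range is a centre, paired with one such set through it. A piece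
is already a `t n`-neighbourhood, so its own `t n`-thickening reaches distance `2 * t n`, the radius
in the target. -/
theorem exists_levelSystem {Ω J : Type*} [MetricSpace Ω] [MeasurableSpace Ω] {m : Measure Ω}
    [IsProbabilityMeasure m] [Nonempty J] {R : J → Set Ω} {δ γ κ c₁ c₂ a b r₀ : ℝ}
    (hB : BallBounds m δ a b r₀) {f : ℝ → ℝ} (hf : ∀ r, 0 < r → 0 < f r)
    (hfδ_anti : AntitoneOn (fun r : ℝ => r ^ (-δ) * f r) (Ioi 0))
    (hfγ_mono : MonotoneOn (fun r : ℝ => r ^ (-γ) * f r) (Ioi 0)) (hγδ : γ < δ)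
    {ρ t : ℕ → ℝ} {I : ℕ → Set J} (hρ : ∀ n, 0 < ρ n) (hρ0 : Tendsto ρ atTop (𝓝 0))
    (ht : ∀ n, 0 < t n) (ht' : ∀ n, 2 * t n ≤ ρ n) (hc₁ : 0 < c₁) (hc₂ : 0 < c₂)
    (hint : ∀ n, IntersectionBounds m R δ γ c₁ c₂ (ρ n) (I n)) (hκ : 0 < κ)
    (hubiq : ∃ r₁, 0 < r₁ ∧ ∀ (x : Ω) (r : ℝ), 0 < r → r ≤ r₁ → ∀ᶠ n in atTop,
      κ * m.real (Metric.ball x r) ≤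
        m.real (Metric.ball x r ∩ ⋃ α ∈ I n, Metric.thickening (ρ n) (R α))) :
    ∃ (C : ℝ) (Z : ℕ → Set Ω) (T : ℕ → Ω → Set Ω),
      LevelSystem m f δ (δ - γ) κ C ρ t (fun n => f (t n) * t n ^ (-γ) * ρ n ^ (γ - δ)) Z T
        (fun n => ⋃ α ∈ I n, Metric.thickening (2 * t n) (R α)) := by
  have hb := hB.b_pos
  have hsel : ∀ n c, ∃ α, c ∈ (⋃ α ∈ I n, R α) → α ∈ I n ∧ c ∈ R α := by
    intro n c
    by_cases hc : c ∈ ⋃ α ∈ I n, R α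
    · obtain ⟨α, hα, hcα⟩ := mem_iUnion₂.1 hc
      exact ⟨α, fun _ => ⟨hα, hcα⟩⟩
    · exact ⟨Classical.arbitrary J, fun h => absurd h hc⟩
  choose sel hsel using hsel
  have htρ : ∀ n, t n ≤ ρ n := fun n => by linarith [ht n, ht' n]
  refine ⟨(b / c₁ + c₂ * 3 ^ γ / c₁) + c₂ * 3 ^ γ * 2 ^ (δ - γ), fun n => ⋃ α ∈ I n, R α,
    fun n c => Metric.ball c (ρ n / 2) ∩ Metric.thickening (t n) (R (sel n c)), ?_⟩
  refine
    { p_pos := sub_pos.2 hγδ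
      κ_pos := hκ
      C_pos := by positivity
      ρ_pos := hρ
      ρ_lim := hρ0
      t_pos := ht
      t_le := htρ
      g_pos := ?_
      ratio_le := ?_
      piece_open := fun n c _ => Metric.isOpen_ball.inter Metric.isOpen_thickening
      piece_subset := fun n c _ => inter_subset_left
      piece_pos := ?_
      piece_ball := ?_
      piece_nhd := ?_
      piece_target := ?_
      ubiq := ?_ }
  · intro n
    have h1 := hf _ (ht n)
    have h2 := ht n
    have h3 := hρ n
    positivity
  · intro n
    have h2 := ht n
    have h3 := hρ n
    refine le_of_eq ?_
    rw [Real.div_rpow h2.le h3.le, Real.rpow_sub h2, Real.rpow_sub h3, Real.rpow_sub h3,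
      Real.rpow_neg h2.le]
    field_simp
  · intro n c hc
    exact (hint n).measureReal_pos hc₁ (hsel n c hc).1 (hsel n c hc).2 (ht n) (htρ n)
  · intro n c hc x r hr hr'
    refine ((hint n).measureReal_ball_inter_le hc₁ hc₂ hB hf hfδ_anti hfγ_mono (hsel n c hc).1
      (hsel n c hc).2 (ht n) (htρ n) x hr hr').trans ?_
    have := hf r hr
    gcongr ?_ * _ * _
    exact le_add_of_nonneg_right (by positivity)
  · intro n c hc w hw hw'
    refine ((hint n).measureReal_thickening_le hc₂ hγδ (hsel n c hc).1 (hsel n c hc).2 (ht n)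
      (ht' n) hw hw').trans ?_
    have h2 := ht n
    have h3 := hρ n
    gcongr
    exact le_add_of_nonneg_left (by positivity)
  · intro n c hc z hz
    obtain ⟨y, ⟨-, hy⟩, hzy⟩ := Metric.mem_thickening_iff.1 hz
    obtain ⟨v, hv, hyv⟩ := Metric.mem_thickening_iff.1 hy
    exact mem_iUnion₂.2 ⟨sel n c, (hsel n c hc).1,
      Metric.mem_thickening_iff.2 ⟨v, hv, by linarith [dist_triangle z y v]⟩⟩
  · obtain ⟨r₁, hr₁, hu⟩ := hubiq
    refine ⟨r₁, hr₁, fun x r hr hr' => (hu x r hr hr').mono fun n hn => hn.trans_eq ?_⟩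
    simp only [Metric.thickening_eq_biUnion_ball, biUnion_iUnion]

/-! ### Truncation of the radii and passage to the limsup set. -/

theorem hausdorffMeasureFun_mono {Ω : Type*} [MetricSpace Ω] (f : ℝ → ℝ) {F F' : Set Ω}
    (h : F ⊆ F') : hausdorffMeasureFun f F ≤ hausdorffMeasureFun f F' := by
  refine iSup₂_mono fun t _ => ?_
  unfold hausdorffPre
  refine le_iInf₂ fun 𝒞 h𝒞 => le_iInf₂ fun hrad hcov => ?_
  exact iInf₂_le_of_le 𝒞 h𝒞 (iInf₂_le_of_le hrad (h.trans hcov) le_rfl)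

/-- As `l n → ∞`, the indices `α` met have unbounded weights, so there are infinitely many of them.
-/
theorem frequently_subset_limsupSet {Ω J : Type*} [MetricSpace Ω] {R : J → Set Ω} {β : J → ℝ}
    (hβ : ∀ α, 0 < β α) {l u : ℕ → ℝ} (hl : Tendsto l atTop atTop) {ψ : ℝ → ℝ}
    (hψ : AntitoneOn ψ (Ioi 0)) {t : ℕ → ℝ} (ht : ∀ n, t n ≤ ψ (u n)) :
    {x | ∃ᶠ n in atTop, x ∈ ⋃ α ∈ {α | l n < β α ∧ β α ≤ u n}, Metric.thickening (t n) (R α)} ⊆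
      limsupSet R β ψ := by
  intro x hx hfin
  obtain ⟨B, hB⟩ := (hfin.image β).bddAbove
  obtain ⟨n, hn, hln⟩ := (Frequently.and_eventually hx (hl.eventually_ge_atTop B)).exists
  obtain ⟨α, ⟨hα, hα'⟩, hxα⟩ := mem_iUnion₂.1 hn
  have hψα : t n ≤ ψ (β α) := (ht n).trans
    (hψ (mem_Ioi.2 (hβ α)) (mem_Ioi.2 ((hβ α).trans_le hα')) hα')
  have hle : β α ≤ B := hB (mem_image_of_mem β
    (show x ∈ Metric.thickening (ψ (β α)) (R α) from Metric.thickening_mono hψα _ hxα))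
  linarith

/-- If `r ^ (-γ) f r` increases while `r ^ (-δ) f r` tends to infinity at `0`, then `γ < δ`. -/
theorem lt_of_monotoneOn_of_tendsto {f : ℝ → ℝ} {γ δ : ℝ} (hf : ∀ r, 0 < r → 0 < f r)
    (hfδ : Tendsto (fun r : ℝ => r ^ (-δ) * f r) (𝓝[>] 0) atTop)
    (hfγ_mono : MonotoneOn (fun r : ℝ => r ^ (-γ) * f r) (Ioi 0)) : γ < δ := by
  by_contra! hle
  obtain ⟨r, hr, hr0, hr1⟩ := ((hfδ.eventually_gt_atTop (f 1)).and
    (Ioo_mem_nhdsGT (zero_lt_one' ℝ))).exists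
  have h1 := hfγ_mono (mem_Ioi.2 hr0) (mem_Ioi.2 one_pos) hr1.le
  simp only [Real.one_rpow, one_mul] at h1
  have h2 : r ^ (-δ) ≤ r ^ (-γ) := Real.rpow_le_rpow_of_exponent_ge hr0 hr1.le (by linarith)
  have h3 := mul_le_mul_of_nonneg_right h2 (hf r hr0).le
  linarith

/-- Truncating and halving the radii `ψ` changes `g` only up to a constant factor. -/
theorem min_gFun_le {f ψ ρ : ℝ → ℝ} {γ δ x : ℝ} (hγ : 0 ≤ γ)
    (hf : ∀ r, 0 < r → 0 < f r)
    (hfδ_anti : AntitoneOn (fun r : ℝ => r ^ (-δ) * f r) (Ioi 0)) (hψ : 0 < ψ x) (hρ : 0 < ρ x)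
    (hρf : (1 : ℝ) ≤ ρ x ^ (-δ) * f (ρ x)) :
    2 ^ (-δ) * min (gFun f ψ ρ γ δ x) 1 ≤
      f (min (ψ x) (ρ x) / 2) * (min (ψ x) (ρ x) / 2) ^ (-γ) * ρ x ^ (γ - δ) := by
  have hhalf : ∀ y : ℝ, 0 < y → 2 ^ (-δ) * (f y * y ^ (-γ)) ≤ f (y / 2) * (y / 2) ^ (-γ) := by
    intro y hy
    have h1 := hfδ_anti (mem_Ioi.2 (half_pos hy)) (mem_Ioi.2 hy) (by linarith)
    have hfy := hf y hy
    simp only [Real.div_rpow hy.le (by norm_num : (0 : ℝ) ≤ 2)] at h1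
    have h2 : (0 : ℝ) < 2 ^ (-δ) := by positivity
    have h3 : 0 < y ^ (-δ) := by positivity
    have h4 : 2 ^ (-δ) * f y ≤ f (y / 2) := by
      rw [div_mul_eq_mul_div, le_div_iff₀ h2] at h1
      refine le_of_mul_le_mul_left ?_ h3
      linarith
    have h5 : y ^ (-γ) ≤ (y / 2) ^ (-γ) :=
      Real.rpow_le_rpow_of_nonpos (half_pos hy) (by linarith) (by linarith)
    have h6 : 0 < y ^ (-γ) := by positivity
    rw [← mul_assoc]
    exact mul_le_mul h4 h5 h6.le (hf _ (half_pos hy)).le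
  have hργ : 0 < ρ x ^ (γ - δ) := by positivity
  -- If `ρ` is the smaller radius, the right side is `ρ^(-δ) f(ρ) ≥ 1`; this is why `g` is compared
  -- only up to `1`.
  have hmin : min (gFun f ψ ρ γ δ x) 1 ≤
      f (min (ψ x) (ρ x)) * (min (ψ x) (ρ x)) ^ (-γ) * ρ x ^ (γ - δ) := by
    rcases min_cases (ψ x) (ρ x) with ⟨h, -⟩ | ⟨h, -⟩ <;> rw [h]
    · exact min_le_left _ _
    · refine (min_le_right _ _).trans (hρf.trans_eq ?_)
      rw [mul_assoc, ← Real.rpow_add hρ]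
      ring_nf
  have h2 : (0 : ℝ) < 2 ^ (-δ) := by positivity
  calc 2 ^ (-δ) * min (gFun f ψ ρ γ δ x) 1
      ≤ 2 ^ (-δ) * (f (min (ψ x) (ρ x)) * (min (ψ x) (ρ x)) ^ (-γ) * ρ x ^ (γ - δ)) := by gcongr
    _ = 2 ^ (-δ) * (f (min (ψ x) (ρ x)) * (min (ψ x) (ρ x)) ^ (-γ)) * ρ x ^ (γ - δ) := by ring
    _ ≤ _ := mul_le_mul_of_nonneg_right (hhalf _ (lt_min hψ hρ)) hργ.le

/-- The limsup set has infinite Hausdorff `f`-measure as soon as the sums of the truncations of `g`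
diverge along lacunary subsequences. -/
theorem hausdorffMeasureFun_limsupSet_eq_top {Ω J : Type*} [MetricSpace Ω] [CompactSpace Ω]
    [MeasurableSpace Ω] [OpensMeasurableSpace Ω] {m : Measure Ω} [IsProbabilityMeasure m] {δ : ℝ}
    (hm : PowerLaw m δ) [Nonempty J] {R : J → Set Ω} {β : J → ℝ} (hβ : IsWeight β)
    {l u : ℕ → ℝ} (hlu : IsLowerUpper l u) {ρ : ℝ → ℝ} (hρ : IsUbiquityFunction ρ)
    {γ : ℝ} (hub : LocallyUbiquitous m R β ρ l u γ) {ψ : ℝ → ℝ} (hψ : IsApproximating ψ)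
    {f : ℝ → ℝ} (hf : IsDimensionFunction f)
    (hfδ : Tendsto (fun r : ℝ => r ^ (-δ) * f r) (𝓝[>] 0) atTop)
    (hfδ_anti : AntitoneOn (fun r : ℝ => r ^ (-δ) * f r) (Ioi 0))
    (hfγ_mono : MonotoneOn (fun r : ℝ => r ^ (-γ) * f r) (Ioi 0))
    (hsub : ∀ (g : ℕ → ℝ) (N : ℕ), (∀ n, 0 < g n) →
      (∀ n, 2 ^ (-δ) * min (gFun f ψ ρ γ δ (u (n + N))) 1 ≤ g n) → ∀ θ : ℝ, 0 < θ →
      ∃ φ : ℕ → ℕ, StrictMono φ ∧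
        (∀ n, ρ (u (φ (n + 1) + N)) ≤ θ * ρ (u (φ n + N))) ∧ ¬ Summable (g ∘ φ)) :
    hausdorffMeasureFun f (limsupSet R β ψ) = ⊤ := by
  obtain ⟨a, b, r₀, hB⟩ := hm.exists_ballBounds
  obtain ⟨⟨κ, r₁, hκ, hr₁, hubiq⟩, hint⟩ := hub
  have hγ := hint.1
  have hγδ := lt_of_monotoneOn_of_tendsto hf.pos hfδ hfγ_mono
  have hu_pos : ∀ n, 0 < u n := fun n => (hlu.l_pos n).trans (hlu.lt n)
  have hu : Tendsto u atTop atTop := tendsto_atTop_mono (fun n => (hlu.lt n).le) hlu.l_lim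
  have hρu : Tendsto (fun n => ρ (u n)) atTop (𝓝 0) := hρ.lim.comp hu
  have hρu_pos : ∀ n, 0 < ρ (u n) := fun n => hρ.pos _ (hu_pos n)
  have hψu_pos : ∀ n, 0 < ψ (u n) := fun n => hψ.pos _ (hu_pos n)
  have hρf : ∀ᶠ n in atTop, (1 : ℝ) ≤ ρ (u n) ^ (-δ) * f (ρ (u n)) :=
    (hfδ.comp (tendsto_nhdsWithin_iff.2
      ⟨hρu, Eventually.of_forall hρu_pos⟩)).eventually_ge_atTop 1
  obtain ⟨c₁, c₂, hc₁, hc₂, hbounds⟩ := hint.exists_bounds hB hρu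
  -- Shifting by `N` turns the eventual hypotheses into ones valid at every level.
  obtain ⟨N, hN⟩ := eventually_atTop.1 (hbounds.and hρf)
  have hN' : ∀ n, N ≤ n + N := fun n => Nat.le_add_left _ _
  have hmin_pos : ∀ n, 0 < min (ψ (u n)) (ρ (u n)) := fun n => lt_min (hψu_pos n) (hρu_pos n)
  obtain ⟨C, Z, T, hLS⟩ := exists_levelSystem (R := R) (κ := κ) hB hf.pos hfδ_anti hfγ_mono hγδ
    -- Halving the minimum secures both `2 t ≤ ρ` and target radius `2 t ≤ ψ`.
    (ρ := fun n => ρ (u (n + N))) (t := fun n => min (ψ (u (n + N))) (ρ (u (n + N))) / 2)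
    (I := fun n => {α | l (n + N) < β α ∧ β α ≤ u (n + N)})
    (fun n => hρu_pos _) (hρu.comp (tendsto_add_atTop_nat N)) (fun n => half_pos (hmin_pos _))
    (fun n => by linarith [min_le_right (ψ (u (n + N))) (ρ (u (n + N)))]) hc₁ hc₂
    (fun n => by
      have h := (hN _ (hN' n)).1
      exact ⟨fun α hα => h.lower α hα.2, fun α hα => h.upper α hα.2⟩) hκ
    ⟨r₁, hr₁, fun x r hr hr' => by
      filter_upwards [(tendsto_add_atTop_nat N).eventually (hubiq x r hr hr')] with n hn
      rw [← ofReal_measureReal (μ := m) (s := Metric.ball x r), ← ENNReal.ofReal_mul hκ.le,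
        ENNReal.ofReal_le_iff_le_toReal (measure_ne_top _ _)] at hn
      exact hn⟩
  have hg : ∀ n, 2 ^ (-δ) * min (gFun f ψ ρ γ δ (u (n + N))) 1 ≤
      f (min (ψ (u (n + N))) (ρ (u (n + N))) / 2) *
        (min (ψ (u (n + N))) (ρ (u (n + N))) / 2) ^ (-γ) * ρ (u (n + N)) ^ (γ - δ) := fun n =>
    min_gFun_le hγ hf.pos hfδ_anti (hψu_pos _) (hρu_pos _) (hN _ (hN' n)).2
  have htop := hLS.hausdorffMeasureFun_eq_top hB hf.pos hf.mono hfδ hfδ_anti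
    (hsub _ N hLS.g_pos hg)
  refine top_unique (htop.symm.trans_le (hausdorffMeasureFun_mono f ?_))
  refine frequently_subset_limsupSet (l := fun n => l (n + N)) (u := fun n => u (n + N)) hβ.pos
    (hlu.l_lim.comp (tendsto_add_atTop_nat N)) hψ.anti fun n => ?_
  linarith [min_le_left (ψ (u (n + N))) (ρ (u (n + N)))]

end Ubiquity

theorem theorem2 {Ω J : Type*} [MetricSpace Ω] [CompactSpace Ω]
    [MeasurableSpace Ω] [OpensMeasurableSpace Ω]
    (m : Measure Ω) [IsProbabilityMeasure m] (δ : ℝ) (hm : Ubiquity.PowerLaw m δ)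
    [Countable J] [Infinite J] (R : J → Set Ω) (β : J → ℝ) (hβ : Ubiquity.IsWeight β)
    (l u : ℕ → ℝ) (hlu : Ubiquity.IsLowerUpper l u)
    (ρ : ℝ → ℝ) (hρ : Ubiquity.IsUbiquityFunction ρ)
    (γ : ℝ) (hub : Ubiquity.LocallyUbiquitous m R β ρ l u γ)
    (ψ : ℝ → ℝ) (hψ : Ubiquity.IsApproximating ψ)
    (f : ℝ → ℝ) (hf : Ubiquity.IsDimensionFunction f)
    (hfδ : Tendsto (fun r : ℝ => r ^ (-δ) * f r) (𝓝[>] 0) atTop)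
    (hfδ_anti : AntitoneOn (fun r : ℝ => r ^ (-δ) * f r) (Ioi 0))
    (hfγ_mono : MonotoneOn (fun r : ℝ => r ^ (-γ) * f r) (Ioi 0)) :
    (Ubiquity.limsupG f ψ ρ γ δ u = 0 → Ubiquity.IsRegularAlong u ρ →
      ∑' n, ENNReal.ofReal (Ubiquity.gFun f ψ ρ γ δ (u n)) = ⊤ →
      Ubiquity.hausdorffMeasureFun f (Ubiquity.limsupSet R β ψ) = ⊤) ∧
    (0 < Ubiquity.limsupG f ψ ρ γ δ u →
      Ubiquity.hausdorffMeasureFun f (Ubiquity.limsupSet R β ψ) = ⊤) := by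
  have hu_pos : ∀ n, 0 < u n := fun n => (hlu.l_pos n).trans (hlu.lt n)
  have hu : Tendsto u atTop atTop := tendsto_atTop_mono (fun n => (hlu.lt n).le) hlu.l_lim
  have hρu_pos : ∀ n, 0 < ρ (u n) := fun n => hρ.pos _ (hu_pos n)
  have h2δ : (0 : ℝ) < 2 ^ (-δ) := by positivity
  refine ⟨fun hG hreg hsum => ?_, fun hG => ?_⟩
  · refine Ubiquity.hausdorffMeasureFun_limsupSet_eq_top hm hβ hlu hρ hub hψ hf hfδ hfδ_anti
      hfγ_mono fun g N hg hgle θ hθ => ?_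
    obtain ⟨c, hc, hc1, hreg⟩ := hreg
    refine Ubiquity.exists_lacunary_of_regular (ρ := fun n => ρ (u (n + N))) (fun n => hρu_pos _)
      hg hc hc1 ?_ ?_ hθ
    · filter_upwards [(tendsto_add_atTop_nat N).eventually hreg] with n hn
      rwa [add_right_comm] at hn
    · intro hgs
      -- Since `G = 0`, the truncation at `1` is eventually inactive and divergence is preserved.
      have hsmall : ∀ᶠ n in atTop, Ubiquity.gFun f ψ ρ γ δ (u n) ≤ 1 := by
        have h1 : limsup (fun n => ENNReal.ofReal (Ubiquity.gFun f ψ ρ γ δ (u n))) atTop < 1 :=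
          hG.trans_lt zero_lt_one
        filter_upwards [eventually_lt_of_limsup_lt h1] with n hn
        exact (ENNReal.ofReal_lt_one.1 hn).le
      have hgF_pos : ∀ n, 0 ≤ Ubiquity.gFun f ψ ρ γ δ (u n) := fun n => by
        have h1 := hψ.pos _ (hu_pos n)
        have h2 := hf.pos _ h1
        have h3 := hρu_pos n
        unfold Ubiquity.gFun
        positivity
      have hsumm : Summable fun n => Ubiquity.gFun f ψ ρ γ δ (u (n + N)) := by
        refine Summable.of_norm_bounded_eventually_nat (hgs.mul_left (2 ^ (-δ))⁻¹) ?_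
        filter_upwards [(tendsto_add_atTop_nat N).eventually hsmall] with n hn
        have h1 := hgle n
        rw [min_eq_left hn] at h1
        rw [Real.norm_of_nonneg (hgF_pos _), inv_mul_eq_div, le_div_iff₀ h2δ]
        linarith
      have hsumm' : Summable fun n => Ubiquity.gFun f ψ ρ γ δ (u n) :=
        (summable_nat_add_iff (f := fun n => Ubiquity.gFun f ψ ρ γ δ (u n)) N).1 hsumm
      exact hsumm'.tsum_ofReal_ne_top hsum
  · obtain ⟨ε, hε, hεG⟩ := exists_between hG
    have hfreq : ∃ᶠ n in atTop, ε.toReal ≤ Ubiquity.gFun f ψ ρ γ δ (u n) := by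
      unfold Ubiquity.limsupG at hεG
      have h1 := frequently_lt_of_lt_limsup (h := hεG)
      refine h1.mono fun n hn => ?_
      exact ((ENNReal.lt_ofReal_iff_toReal_lt hεG.ne_top).1 hn).le
    have hε' : 0 < ε.toReal := ENNReal.toReal_pos hε.ne' hεG.ne_top
    refine Ubiquity.hausdorffMeasureFun_limsupSet_eq_top hm hβ hlu hρ hub hψ hf hfδ hfδ_anti
      hfγ_mono fun g N _ hgle θ hθ => ?_
    -- Truncation only lowers the recurring bound from `ε` to `min ε 1`, so no regularity of `ρ` is
    -- needed.
    refine Ubiquity.exists_lacunary_of_frequently (ρ := fun n => ρ (u (n + N)))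
      (ε := 2 ^ (-δ) * min ε.toReal 1) (fun n => hρu_pos _)
      ((hρ.lim.comp hu).comp (tendsto_add_atTop_nat N)) (by positivity) ?_ hθ
    rw [← map_add_atTop_eq_nat N, frequently_map] at hfreq
    refine hfreq.mono fun n hn => le_trans ?_ (hgle n)
    gcongr
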